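/- **Setting.** Let $\Sigma$ be a finite alphabet, $V\subset\Sigma^{+}$ a finite vocabulary containing every character, and $D=[r_1,\dots,r_m]$ an ordered list of merge rules $(x,y)\to xy$ with $x,y,xy\in V$; $r_1$ has the highest priority. Applying a rule to a token sequence replaces adjacent occurrences of $x,y$ by $xy$ in one scan from left to right. The tokenization $\mathbb T(s)$ is obtained from the sequence of characters of $s$ by applying $r_1,\dots,r_m$ in this order, once each. For $s\neq\varepsilon$ let $\theta(s)$ be the last token of $\mathbb T(s)$; $\theta(\varepsilon)=\varepsilon$ by convention. A token $u\in V$ is *canonical* if $\mathbb T(u)=[u]$; $\mathcal V$ is the set of canonical tokens, $t$ is the maximum length of a token in $\mathcal V$, and $\tau(s)$ is the longest suffix of $s$ in $\mathcal V$. The *canonical rule* of a canonical token $u$ with $|u|>1$ is the rule $(x,y)$ whose application completes the tokenization of $u$ to $[u]$; put $\mathrm{pre}(u)=x$, $\mathrm{suc}(u)=y$. The *successor forest* has node set $\mathcal V$ and edges $u\to\mathrm{suc}(u)$ ($|u|>1$), with $\mathrm{suc}(u)$ the parent of $u$. $\mathrm{SufSucTree}(\tau)$ is its subgraph induced by the canonical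 suffixes of $\tau$. Traverse the forest in depth-first pre-order, the roots (single characters) in any fixed order and the children of a node from lowest to highest priority of their canonical rules; $\mathrm{dfs\_in}$ and $\mathrm{dfs\_out}$ are the entry and exit times, so that the subtree of $u$ occupies $[\mathrm{dfs\_in}(u),\mathrm{dfs\_out}(u))$. For $u\in\mathcal V$, $|u|>1$, let $I_u=[L_u,R_u)$, where $L_u=\mathrm{dfs\_in}(\mathrm{pre}(u))$ and $R_u=\mathrm{dfs\_in}(v)$ for the first child $v$ of $\mathrm{pre}(u)$ in this order whose canonical rule has priority at least that of $u$, or $R_u=\mathrm{dfs\_out}(\mathrm{pre}(u))$ if there is none. A *centroid search tree* (CST) of $\mathrm{SufSucTree}(\tau)$ is a tree obtained by recursively choosing a centroid $u$ of the current weakly connected component $K$ (each component of $K\setminus\{u\}$ has at most $|K|/2$ nodes); the node of $u$ points to the CST of the component of its parent and, for each child of $u$ in $\mathrm{SufSucTree}(\tau)$, to the CST of that child's component (null if there is none). The children are stored sorted by $L$. **Algorithm.** Precomputed are the Aho–Corasick automaton of $\mathcal V$ (its states are the prefixes of canonical tokens), with each state annotated by itself if it lies in $\mathcal V$ and otherwise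 by the annotation of its suffix link; a CST for each $\tau\in\mathcal V$; and tables of $\mathrm{dfs\_in}$, $L$, $R$ and token lengths. A history query $\mathcal H(\ell)$ returns $\theta$ of the current string with its last $\ell$ characters removed. When $c$ is appended to $s$, the automaton makes one transition, the annotation of the new state is read, and its CST is searched from the root. At a node with centroid $u$: $u$ is valid if $|u|=1$ or $\mathrm{dfs\_in}(\mathcal H(|\mathrm{suc}(u)|))\in I_u$. If $u$ is invalid, go to the CST of the component of the parent of $u$. If $u$ is valid, find by binary search a child $v$ of $u$ in $\mathrm{SufSucTree}(\tau)$ with $\mathrm{dfs\_in}(\mathcal H(|u|))\in I_v$; if it exists go to the CST of its component, otherwise return $u$. The cost is the number of elementary steps: table look-ups, history queries, pointer moves, index arithmetic, comparisons, and appending to the history are one step each. **Theorem.** There is an absolute constant $C$ such that the following holds for all $\Sigma,V,D$ as above. A CST exists for every $\tau\in\mathcal V$, and for every choice of CSTs: 1. The CST of $\tau$ has at most $\lfloor\log_2|\tau|\rfloor+1$ levels. 2. For every string $s$ and character $c$, starting from the automaton state reached by $s$ and with correct history answers, the annotation of the state reached by $sc$ is $\tau(sc)$, the update returns $\theta(sc)$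 and the automaton state reached by $sc$, and it takes at most $C\,(1+\log^2|\tau(sc)|)$ steps. 3. If the history is an array filled by the algorithm itself, then running it from scratch on an input $s$ of length $n$ stores $\theta(p)$ for every prefix $p$ of $s$; processing a further character costs at most $C\,(1+\log^2 t)$ steps, and the whole input costs at most $C\,n\,(1+\log^2 t)$ steps. -/

import Mathlib

/-!
# Byte pair encoding, the successor forest, and the incremental algorithm

Strings and tokens are both lists of characters.
-/

/-! ## Computations with a step count -/

/-- A computation together with the number of elementary steps it takes. -/
structure Cost (β : Type*) where
  val : β
  time : ℕ

namespace Cost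

/-- One elementary step: a table or array access, a history query, following a pointer,
an arithmetic operation on indices, a comparison, or appending to an array. -/
def op {β : Type*} (b : β) : Cost β := ⟨b, 1⟩

/-- A result that needs no further step. -/
def ret {β : Type*} (b : β) : Cost β := ⟨b, 0⟩

/-- Run `m`, then run `f` on its result; the numbers of steps add up. -/
def bind {β γ : Type*} (m : Cost β) (f : β → Cost γ) : Cost γ :=
  ⟨(f m.val).val, m.time + (f m.val).time⟩

end Cost

/-! ## Centroid search trees -/

/-- The shape of a centroid search tree. A node stores its centroid `u`, a pointer `up` to the
search tree of the component of the parent of `u`, the array `child` of the children of `u`,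
and for each of them a pointer `down` to the search tree of its component.
`nil` is the null pointer (the component is empty). -/
inductive CST (α : Type*) where
  | nil : CST α
  | node (u : List α) (up : CST α) (deg : ℕ) (child : Fin deg → List α)
      (down : Fin deg → CST α) : CST α

/-- The number of nodes on a longest downward path. -/
def CST.height {α : Type*} : CST α → ℕ
  | .nil => 0
  | .node _ up _ _ down => max up.height (Finset.univ.sup fun i => (down i).height) + 1

/-! ## Dictionaries and tokenization -/

/-- A finite vocabulary `V ⊆ Σ⁺` that contains every character as an atomic token, and an ordered
list of merge rules `(x, y) → xy` (highest priority first) between tokens. -/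
structure BPE (α : Type*) where
  vocab : Finset (List α)
  rules : List (List α × List α)
  nil_notMem : [] ∉ vocab
  atomic_mem : ∀ c : α, [c] ∈ vocab
  rules_mem : ∀ r ∈ rules, r.1 ∈ vocab ∧ r.2 ∈ vocab ∧ r.1 ++ r.2 ∈ vocab

namespace BPE

variable {α : Type*} [DecidableEq α]

/-- Replace adjacent tokens `x, y` by `xy`, scanning once from left to right. -/
def mergePass (x y : List α) : List (List α) → List (List α)
  | a :: b :: rest =>
      if a = x ∧ b = y then (x ++ y) :: mergePass x y rest
      else a :: mergePass x y (b :: rest)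
  | φ => φ

/-- Start from the sequence of characters of `s` and apply the given rules in order. -/
def applyRules (rs : List (List α × List α)) (s : List α) : List (List α) :=
  rs.foldl (fun φ r => mergePass r.1 r.2 φ) (s.map fun c => [c])

/-- The standard BPE tokenization of `s`. -/
def tokenize (B : BPE α) (s : List α) : List (List α) := applyRules B.rules s

/-- The last token `θ(s)`; for the empty string this is `[]`, the virtual root. -/
def lastToken (B : BPE α) (s : List α) : List α := (B.tokenize s).getLastD []

/-- The normalized vocabulary: the canonical tokens. -/
def canon (B : BPE α) : Finset (List α) := B.vocab.filter fun t => B.tokenize t = [t]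

/-- The maximum length of a canonical token. -/
def maxLen (B : BPE α) : ℕ := B.canon.sup List.length

/-- The longest canonical token that is a suffix of `s` (`[]` for the empty string). -/
def longestSuffixToken (B : BPE α) (s : List α) : List α :=
  (s.tails.find? fun t => decide (t ∈ B.canon)).getD []

/-! ## Canonical rules and the successor forest -/

/-- The index of the canonical rule of a non-atomic canonical token `t`: the rule whose
application completes the tokenization of the string `t` to `[t]`.
A smaller index means a higher priority. -/
def ruleIdx (B : BPE α) (t : List α) : ℕ :=
  ((List.range B.rules.length).find? fun k =>
    decide (applyRules (B.rules.take (k + 1)) t = [t])).getD 0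

/-- The predecessor of a non-atomic canonical token (`[]` for other strings). -/
def pre (B : BPE α) (t : List α) : List α :=
  if t ∈ B.canon ∧ 1 < t.length then (B.rules.getD (B.ruleIdx t) ([], [])).1 else []

/-- The successor of a non-atomic canonical token (`[]` for other strings). -/
def suc (B : BPE α) (t : List α) : List α :=
  if t ∈ B.canon ∧ 1 < t.length then (B.rules.getD (B.ruleIdx t) ([], [])).2 else []

/-- `(u, v)` is an edge of the successor forest: `u` is a non-atomic canonical token and
`v` is its successor. -/
def SucEdge (B : BPE α) (u v : List α) : Prop := u ∈ B.canon ∧ 1 < u.length ∧ B.suc u = v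

instance (B : BPE α) (u v : List α) : Decidable (B.SucEdge u v) := by
  unfold SucEdge; infer_instance

/-- The children of `u` in the successor forest, from lowest to highest priority of their
canonical rules: go through the rules backwards and keep the token produced by the rule
if this is the canonical rule of a child of `u`. -/
def childrenByPriority (B : BPE α) (u : List α) : List (List α) :=
  (List.range B.rules.length).reverse.filterMap fun k =>
    let r := B.rules.getD k ([], [])
    let t := r.1 ++ r.2
    if B.ruleIdx t = k ∧ B.SucEdge t u then some t else none

/-! ## Depth-first linearization and valid intervals -/

/-- Pre-order traversal of the subtree of `u`, cut off below depth `fuel`. -/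
def preorderAux (B : BPE α) : ℕ → List α → List (List α)
  | 0, u => [u]
  | fuel + 1, u => u :: (B.childrenByPriority u).flatMap (preorderAux B fuel)

/-- Pre-order traversal of the whole subtree of `u` (lengths strictly increase from a token to
its children, so the depth of the forest is less than `maxLen`). -/
def preorder (B : BPE α) (u : List α) : List (List α) := B.preorderAux B.maxLen u

/-- Pre-order traversal of the successor forest, where the atomic tokens are visited in the
order given by `order`, a list of all characters. -/
def forestOrder (B : BPE α) (order : List α) : List (List α) :=
  order.flatMap fun c => B.preorder [c]

/-- Entry timestamp. -/
def dfsIn (B : BPE α) (order : List α) (u : List α) : ℕ := (B.forestOrder order).idxOf u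

/-- Exit timestamp: the number of nodes entered once the subtree of `u` is fully explored. -/
def dfsOut (B : BPE α) (order : List α) (u : List α) : ℕ :=
  B.dfsIn order u + (B.preorder u).length

/-- Left end of the valid interval `[L, R)` of a non-atomic canonical token. -/
def intervalL (B : BPE α) (order : List α) (t : List α) : ℕ := B.dfsIn order (B.pre t)

/-- Right end of the valid interval `[L, R)` of a non-atomic canonical token: the entry time of
the first child of `pre t` whose priority is at least that of `t`, or else the exit time of
`pre t`. -/
def intervalR (B : BPE α) (order : List α) (t : List α) : ℕ :=
  match (B.childrenByPriority (B.pre t)).find? fun u => decide (B.ruleIdx u ≤ B.ruleIdx t) with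
  | some u => B.dfsIn order u
  | none => B.dfsOut order (B.pre t)

/-! ## The annotated Aho–Corasick automaton -/

/-- The states are the nodes of the trie of the canonical tokens, i.e. their prefixes. -/
def IsState (B : BPE α) (u : List α) : Prop := ∃ t ∈ B.canon, u <+: t

instance (B : BPE α) (u : List α) : Decidable (B.IsState u) := by
  unfold IsState; infer_instance

/-- The suffix link: the longest proper suffix that is a state (the root `[]` if there is none). -/
def link (B : BPE α) (u : List α) : List α :=
  (u.tails.tail.find? fun w => decide (B.IsState w)).getD []

theorem length_link_lt (B : BPE α) {u : List α} (hu : u ≠ []) :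
    (B.link u).length < u.length := by
  cases u with
  | nil => exact absurd rfl hu
  | cons a l =>
    unfold link
    cases h : ((a :: l).tails.tail.find? fun w => decide (B.IsState w)) with
    | none => simp
    | some w =>
      have hw := List.mem_of_find?_eq_some h
      have hw' : w <:+ l := by simpa using hw
      have := hw'.length_le
      simp only [Option.getD_some, List.length_cons]
      omega

/-- The transition function. -/
def delta (B : BPE α) (u : List α) (c : α) : List α :=
  if B.IsState (u ++ [c]) then u ++ [c]
  else if _h : u = [] then []
  else B.delta (B.link u) c
termination_by u.length
decreasing_by exact B.length_link_lt _h

/-- The annotation of a state: the state itself if it is a canonical token, otherwise the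
annotation of its suffix link (`[]` means that there is no token). -/
def annot (B : BPE α) (u : List α) : List α :=
  if u ∈ B.canon then u
  else if _h : u = [] then []
  else B.annot (B.link u)
termination_by u.length
decreasing_by exact B.length_link_lt _h

/-- The state that the automaton reaches from the root on reading `s`. -/
def acState (B : BPE α) (s : List α) : List α := s.foldl B.delta []

/-! ## Suffix-successor trees and their centroid decompositions -/

/-- The nodes of the suffix-successor tree of `τ`: the canonical tokens that are suffixes of `τ`.
The edges are those of the successor forest. -/
def sufSucTree (B : BPE α) (τ : List α) : Finset (List α) := B.canon.filter fun t => t <:+ τ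

/-- Two nodes of `S` joined by an edge of the successor forest, in either direction. -/
def AdjIn (B : BPE α) (S : Finset (List α)) (a b : List α) : Prop :=
  a ∈ S ∧ b ∈ S ∧ (B.SucEdge a b ∨ B.SucEdge b a)

open Classical in
/-- The weakly connected component of `v` in the subgraph of the successor forest induced by `S`
(empty if `v ∉ S`). -/
noncomputable def component (B : BPE α) (S : Finset (List α)) (v : List α) : Finset (List α) :=
  S.filter fun w => v ∈ S ∧ Relation.ReflTransGen (B.AdjIn S) v w

/-- `u` is a centroid of `K`: the components left after removing `u` have at most half the size
of `K`. -/
def IsCentroid (B : BPE α) (K : Finset (List α)) (u : List α) : Prop :=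
  u ∈ K ∧ ∀ v ∈ K.erase u, 2 * (B.component (K.erase u) v).card ≤ K.card

/-- `T` is a centroid search tree for the component `K` of the suffix-successor tree of `τ`.
At each node, `child` lists the children of the centroid in the whole suffix-successor tree,
sorted by their valid intervals. -/
def IsCST (B : BPE α) (order : List α) (τ : List α) : CST α → Finset (List α) → Prop
  | .nil, K => K = ∅
  | .node u up _ child down, K =>
      B.IsCentroid K u ∧
      IsCST B order τ up (B.component (K.erase u) (B.suc u)) ∧
      (∀ v, v ∈ Set.range child ↔ v ∈ B.sufSucTree τ ∧ B.SucEdge v u) ∧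
      StrictMono (fun i => B.intervalL order (child i)) ∧
      ∀ i, IsCST B order τ (down i) (B.component (K.erase u) (child i))

/-- A table that holds a centroid search tree of the suffix-successor tree of each canonical
token. -/
def IsCSTTable (B : BPE α) (order : List α) (cst : List α → CST α) : Prop :=
  ∀ τ ∈ B.canon, B.IsCST order τ (cst τ) (B.sufSucTree τ)

/-! ## The incremental algorithm

The precomputed tables are `delta`, `annot`, `cst`, `dfsIn`, `intervalL`, `intervalR`, and the
lengths of the tokens and of their successors. -/

open Cost

/-- Binary search in a sorted array: the first index in `[lo, hi)` whose key is larger than `x`,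
or `hi` if there is none. -/
def bsearch {n : ℕ} (key : Fin n → ℕ) (x lo hi : ℕ) (hn : hi ≤ n) : Cost ℕ :=
  (op (decide (lo < hi))).bind fun _ =>
  if h : lo < hi then
    (op ((lo + hi) / 2)).bind fun _ =>
    (op (key ⟨(lo + hi) / 2, by omega⟩)).bind fun k =>
    (op (decide (k ≤ x))).bind fun le =>
    if le then bsearch key x ((lo + hi) / 2 + 1) hi hn
    else bsearch key x lo ((lo + hi) / 2) (by omega)
  else ret lo
termination_by hi - lo
decreasing_by all_goals omega

/-- Does the timestamp `x` lie in the valid interval of `t`? -/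
def inInterval (B : BPE α) (order : List α) (t : List α) (x : ℕ) : Cost Bool :=
  (op (B.intervalL order t)).bind fun l =>
  (op (B.intervalR order t)).bind fun r =>
  (op (decide (l ≤ x))).bind fun b₁ =>
  (op (decide (x < r))).bind fun b₂ =>
  op (b₁ && b₂)

/-- The validity check at a centroid `u`: atomic tokens are valid; otherwise query the history
at `|suc u|` and test the interval of `u`. -/
def checkNode (B : BPE α) (order : List α) (H : ℕ → List α) (u : List α) : Cost Bool :=
  (op u.length).bind fun len =>
  (op (decide (len ≤ 1))).bind fun atomic =>
  if atomic then ret true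
  else
    (op (B.suc u).length).bind fun ℓ =>
    (op (H ℓ)).bind fun k =>
    (op (B.dfsIn order k)).bind fun x =>
    B.inInterval order u x

/-- Look for a valid child of `u`: query the history at `|u|`, find by binary search the last
child whose interval starts at or before the timestamp, and test it. -/
def findChild (B : BPE α) (order : List α) (H : ℕ → List α) (u : List α) {deg : ℕ}
    (child : Fin deg → List α) : Cost (Option (Fin deg)) :=
  (op u.length).bind fun ℓ =>
  (op (H ℓ)).bind fun k =>
  (op (B.dfsIn order k)).bind fun x =>
  (bsearch (fun i => B.intervalL order (child i)) x 0 deg le_rfl).bind fun j =>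
  (op (decide (0 < j))).bind fun _ =>
  -- the second condition always holds, as `j ≤ deg`
  if h : 0 < j ∧ j - 1 < deg then
    (op (child ⟨j - 1, h.2⟩)).bind fun v =>
    (B.inInterval order v x).bind fun ok =>
    if ok then ret (some ⟨j - 1, h.2⟩) else ret none
  else ret none

/-- The search down a centroid search tree with history interface `H`. An invalid centroid sends
the search upwards, a valid child of a valid centroid sends it to the component of that child,
and a valid centroid without valid children is the answer. -/
def search (B : BPE α) (order : List α) (H : ℕ → List α) : CST α → Cost (List α)
  | .nil => ret []
  | .node u up _ child down =>
      (B.checkNode order H u).bind fun valid =>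
      if valid then
        (B.findChild order H u child).bind fun next =>
        match next with
        | none => ret u
        | some i => (op i).bind fun i => search B order H (down i)
      else (op ()).bind fun _ => search B order H up

/-- Process one more character `c`: from the automaton state `q` before reading `c`, compute the
new state and the new last token. -/
def update (B : BPE α) (order : List α) (cst : List α → CST α) (H : ℕ → List α)
    (q : List α) (c : α) : Cost (List α × List α) :=
  (op (B.delta q c)).bind fun q' =>
  (op (B.annot q')).bind fun τ =>
  (op (cst τ)).bind fun T =>
  (B.search order H T).bind fun θ =>
  ret (q', θ)

/-- The data kept by the algorithm between two characters: the automaton state, and an array that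
holds at index `i` the last token of the prefix of length `i` of the input read so far. -/
structure Memory (α : Type*) where
  state : List α
  hist : Array (List α)

/-- One round: update with the array as the history, and record the new last token. If the string
after appending `c` has length `m`, then `hist` has size `m` and removing `ℓ` characters
from the end gives the prefix of length `m - ℓ`. -/
def step (B : BPE α) (order : List α) (cst : List α → CST α) (M : Memory α) (c : α) :
    Cost (Memory α) :=
  (B.update order cst (fun ℓ => M.hist.getD (M.hist.size - ℓ) []) M.state c).bind fun r =>
  (op (M.hist.push r.2)).bind fun hist =>
  ret ⟨r.1, hist⟩

/-- Process a string character by character. -/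
def runFrom (B : BPE α) (order : List α) (cst : List α → CST α) :
    Memory α → List α → Cost (Memory α)
  | M, [] => ret M
  | M, c :: s => (B.step order cst M c).bind fun M' => runFrom B order cst M' s

/-- Process a string from scratch. -/
def run (B : BPE α) (order : List α) (cst : List α → CST α) (s : List α) : Cost (Memory α) :=
  B.runFrom order cst ⟨[], #[[]]⟩ s

/-- `H` answers the history queries for the string `w`: for `0 < ℓ < |w|` it returns the last token
of the prefix obtained from `w` by removing `ℓ` characters from the end. -/
def IsHistory (B : BPE α) (w : List α) (H : ℕ → List α) : Prop :=
  ∀ ℓ, 0 < ℓ → ℓ < w.length → H ℓ = B.lastToken (w.take (w.length - ℓ))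

end BPE

/-!
Whether a merge crosses a given boundary depends on the string on its left only through the last
token of that string. Hence, for a canonical token `v` with successor `u`, the last token of
`s ++ u` descends from `v` exactly when the last token of `s` is `pre v`, or lies below a child of
`pre v` whose canonical rule comes later than that of `v`. As children are traversed from lowest to
highest priority, these tokens form an initial segment of the preorder of the subtree of `pre v`,
namely the interval of `v`. So one history query decides whether a canonical suffix `v` of the
current string is an ancestor of its last token. That last token is a suffix of the longest
canonical suffix `τ`, and the tests locate it in the suffix-successor tree of `τ`. A centroid
search halves the component at each level, and the binary search among the children succeeds since
the ancestor tests of distinct siblings exclude each other.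
-/

section List

variable {β : Type*}

theorem takeWhile_eq_filter_of_pairwise {p : β → Bool} {l : List β}
    (hp : l.Pairwise fun a b => p b → p a) : l.takeWhile p = l.filter p := by
  induction hp with
  | nil => rfl
  | @cons a l ha _ ih =>
    by_cases h : p a
    · rw [List.takeWhile_cons_of_pos h, List.filter_cons_of_pos h, ih]
    · rw [List.takeWhile_cons_of_neg h, List.filter_cons_of_neg h, eq_comm, List.filter_eq_nil_iff]
      exact fun b hb hpb => h (ha b hb hpb)

theorem idxOf_mem_segment_iff [BEq β] [LawfulBEq β] {P Q S : List β} {x : β}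
    (h : (P ++ Q ++ S).Nodup) :
    P.length ≤ (P ++ Q ++ S).idxOf x ∧ (P ++ Q ++ S).idxOf x < P.length + Q.length ↔ x ∈ Q := by
  rw [List.append_assoc] at h ⊢
  by_cases hP : x ∈ P
  · have hQ : x ∉ Q := fun hQ => (List.nodup_append'.1 h).2.2 hP (List.mem_append_left _ hQ)
    have hidx := List.idxOf_lt_length_iff.2 hP
    rw [List.idxOf_append_of_mem hP]
    exact iff_of_false (by omega) hQ
  · rw [List.idxOf_append_of_notMem hP]
    by_cases hQ : x ∈ Q
    · have hidx := List.idxOf_lt_length_iff.2 hQ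
      rw [List.idxOf_append_of_mem hQ]
      exact iff_of_true (by omega) hQ
    · rw [List.idxOf_append_of_notMem hQ]
      exact iff_of_false (by omega) hQ

end List

section LongestSuffix

variable {α : Type*} {p q : List α → Prop} {s t u v w : List α} {c : α}

/-- `w` is the longest suffix of `s` with the property `p`, or `[]` if there is none. -/
def IsLongestSuffix (p : List α → Prop) (s w : List α) : Prop :=
  w <:+ s ∧ (p w ∨ w = []) ∧ ∀ t, t <:+ s → p t → t <:+ w

namespace IsLongestSuffix

theorem self (h : p s) : IsLongestSuffix p s s :=
  ⟨List.suffix_rfl, .inl h, fun _ ht _ => ht⟩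

theorem nil (p : List α → Prop) : IsLongestSuffix p [] [] :=
  ⟨List.nil_suffix, .inr rfl, fun _ ht _ => ht⟩

theorem unique (hv : IsLongestSuffix p s v) (hw : IsLongestSuffix p s w) : v = w := by
  have suffix_of {v w : List α} (hv : IsLongestSuffix p s v) (hw : IsLongestSuffix p s w) :
      v <:+ w := by
    rcases hv.2.1 with h | rfl
    · exact hw.2.2 v hv.1 h
    · exact List.nil_suffix
  exact (suffix_of hv hw).eq_of_length_le (suffix_of hw hv).length_le

theorem of_tail (hs : ¬ p s) (h : IsLongestSuffix p s.tail w) : IsLongestSuffix p s w := by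
  refine ⟨h.1.trans (List.tail_suffix s), h.2.1, fun t ht hpt => ?_⟩
  cases s with
  | nil => exact absurd (List.suffix_nil.1 ht ▸ hpt) hs
  | cons a s =>
    exact h.2.2 t ((List.suffix_cons_iff.1 ht).resolve_left fun hta => hs (hta ▸ hpt)) hpt

theorem trans (hpq : ∀ t, q t → p t) (hv : IsLongestSuffix p s v) (hw : IsLongestSuffix q v w) :
    IsLongestSuffix q s w :=
  ⟨hw.1.trans hv.1, hw.2.1, fun t ht hqt => hw.2.2 t (hv.2.2 t ht (hpq t hqt)) hqt⟩

theorem concat (hp : ∀ t, p (t ++ [c]) → p t) (hv : IsLongestSuffix p s v)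
    (hw : IsLongestSuffix p (v ++ [c]) w) : IsLongestSuffix p (s ++ [c]) w := by
  refine ⟨hw.1.trans (List.suffix_append_inj_of_length_eq rfl |>.2 ⟨hv.1, rfl⟩), hw.2.1,
    fun t ht hpt => ?_⟩
  rcases List.suffix_concat_iff.1 ht with rfl | ⟨t, rfl, hts⟩
  · exact List.nil_suffix
  · exact hw.2.2 _ (List.suffix_append_inj_of_length_eq rfl |>.2
      ⟨hv.2.2 t hts (hp t hpt), rfl⟩) hpt

end IsLongestSuffix

theorem isLongestSuffix_find? (p : List α → Prop) [DecidablePred p] (s : List α) :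
    IsLongestSuffix p s ((s.tails.find? fun t => decide (p t)).getD []) := by
  induction s with
  | nil => by_cases h : p [] <;> simpa [h] using .nil p
  | cons a s ih =>
    rw [List.tails_cons, List.find?_cons]
    by_cases h : p (a :: s)
    · simpa [h] using .self h
    · simpa [h] using .of_tail h ih

end LongestSuffix

section Forest

open Relation

variable {V : Type*} {R : V → V → Prop} {K S : Finset V} {a b c k u v w : V}

/-- `R` is the relation between a node and its parent in a rooted forest. -/
structure IsForest (R : V → V → Prop) : Prop where
  rightUnique : Relator.RightUnique R
  acyclic : ∀ a, ¬ TransGen R a a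

namespace IsForest

theorem eq_or_reflTransGen (hR : IsForest R) (hab : ReflTransGen R a b) (hac : R a c) :
    a = b ∨ ReflTransGen R c b :=
  hab.cases_head.imp_right fun ⟨_, had, hdb⟩ => hR.rightUnique had hac ▸ hdb

theorem not_reflTransGen_of_rel (hR : IsForest R) (h : R a b) : ¬ ReflTransGen R b a := fun hba =>
  hR.acyclic a (.head' h hba)

theorem sibling_unique (hR : IsForest R) (hv : R v u) (hw : R w u)
    (hkv : ReflTransGen R k v) (hkw : ReflTransGen R k w) : v = w := by
  rcases ReflTransGen.total_of_right_unique hR.rightUnique hkv hkw with h | h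
  · exact (hR.eq_or_reflTransGen h hv).resolve_right (hR.not_reflTransGen_of_rel hw)
  · exact ((hR.eq_or_reflTransGen h hw).resolve_right (hR.not_reflTransGen_of_rel hv)).symm

end IsForest

/-- The nodes `a` and `b` of `S` are joined by an edge of `R`, in either direction. -/
def InducedAdj (R : V → V → Prop) (S : Finset V) (a b : V) : Prop :=
  a ∈ S ∧ b ∈ S ∧ (R a b ∨ R b a)

/-- `b` can be reached from `a` by an undirected path that stays in `S`. -/
abbrev InducedReach (R : V → V → Prop) (S : Finset V) (a b : V) : Prop :=
  ReflTransGen (InducedAdj R S) a b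

theorem InducedReach.symm (h : InducedReach R S a b) : InducedReach R S b a :=
  h.rec .refl fun _ hbc ih => .head ⟨hbc.2.1, hbc.1, hbc.2.2.symm⟩ ih

/-- The subgraph of `R` induced by `S` is connected or empty. -/
def InducedConnected (R : V → V → Prop) (S : Finset V) : Prop :=
  ∀ a ∈ S, ∀ b ∈ S, InducedReach R S a b

section Erase

variable [DecidableEq V]

theorem InducedConnected.exists_neighbor (hK : InducedConnected R K) (hu : u ∈ K) (hk : k ∈ K)
    (hne : k ≠ u) :
    ∃ w ∈ K.erase u, (R u w ∨ R w u) ∧ InducedReach R (K.erase u) w k := by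
  have last_exit {b : V} (hb : InducedReach R K u b) : b = u ∨
      ∃ w ∈ K.erase u, (R u w ∨ R w u) ∧ InducedReach R (K.erase u) w b := by
    induction hb with
    | refl => exact .inl rfl
    | @tail b c _ hbc ih =>
      refine or_iff_not_imp_left.2 fun hc => ?_
      have hcK := Finset.mem_erase.2 ⟨hc, hbc.2.1⟩
      by_cases hb : b = u
      · exact ⟨c, hcK, hb ▸ hbc.2.2, .refl⟩
      · obtain ⟨w, hw, huw, hwb⟩ := ih.resolve_left hb
        exact ⟨w, hw, huw, hwb.tail ⟨Finset.mem_erase.2 ⟨hb, hbc.1⟩, hcK, hbc.2.2⟩⟩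
  exact (last_exit (hK u hu k hk)).resolve_left hne

namespace IsForest

theorem reflTransGen_of_reach_child (hR : IsForest R) (hw : R w u)
    (h : InducedReach R (K.erase u) w k) : ReflTransGen R k w := by
  induction h with
  | refl => exact .refl
  | tail _ hab ih =>
    rcases hab.2.2 with hup | hdown
    · rcases hR.eq_or_reflTransGen ih hup with rfl | hdesc
      · exact absurd (hR.rightUnique hup hw) (Finset.ne_of_mem_erase hab.2.1)
      · exact hdesc
    · exact .head hdown ih

theorem not_reflTransGen_of_reach_parent (hR : IsForest R) (hw : R u w)
    (h : InducedReach R (K.erase u) w k) : ¬ ReflTransGen R k u := by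
  induction h with
  | refl => exact hR.not_reflTransGen_of_rel hw
  | tail _ hab ih =>
    intro hdesc
    rcases hab.2.2 with hup | hdown
    · exact ih (.head hup hdesc)
    · rcases hR.eq_or_reflTransGen hdesc hdown with rfl | h
      · exact Finset.ne_of_mem_erase hab.2.1 rfl
      · exact ih h

theorem exists_reach_child (hR : IsForest R) (hK : InducedConnected R K) (hu : u ∈ K)
    (hk : k ∈ K) (hne : k ≠ u) (hku : ReflTransGen R k u) :
    ∃ w ∈ K.erase u, R w u ∧ ReflTransGen R k w ∧ InducedReach R (K.erase u) w k := by
  obtain ⟨w, hw, huw | hwu, hwk⟩ := hK.exists_neighbor hu hk hne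
  · exact absurd hku (hR.not_reflTransGen_of_reach_parent huw hwk)
  · exact ⟨w, hw, hwu, hR.reflTransGen_of_reach_child hwu hwk, hwk⟩

theorem exists_reach_parent (hR : IsForest R) (hK : InducedConnected R K) (hu : u ∈ K)
    (hk : k ∈ K) (hku : ¬ ReflTransGen R k u) :
    ∃ w ∈ K.erase u, R u w ∧ InducedReach R (K.erase u) w k := by
  obtain ⟨w, hw, huw | hwu, hwk⟩ := hK.exists_neighbor hu hk fun h => hku (h ▸ .refl)
  · exact ⟨w, hw, huw, hwk⟩
  · exact absurd ((hR.reflTransGen_of_reach_child hwu hwk).tail hwu) hku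

end IsForest

end Erase

open Classical in
/-- The descendants of `v` that lie in `K`. -/
noncomputable def descendantsIn (R : V → V → Prop) (K : Finset V) (v : V) : Finset V :=
  K.filter fun k => ReflTransGen R k v

theorem mem_descendantsIn : k ∈ descendantsIn R K v ↔ k ∈ K ∧ ReflTransGen R k v := by
  simp [descendantsIn]

theorem descendantsIn_subset : descendantsIn R K v ⊆ K := fun _ hk => (mem_descendantsIn.1 hk).1

namespace IsForest

theorem card_descendantsIn_lt (hR : IsForest R) (hv : v ∈ K) (h : R w v) :
    (descendantsIn R K w).card < (descendantsIn R K v).card := by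
  refine Finset.card_lt_card (Finset.ssubset_iff_of_subset (fun k hk => ?_) |>.2 ⟨v, ?_, ?_⟩)
  · exact mem_descendantsIn.2
      ⟨(mem_descendantsIn.1 hk).1, (mem_descendantsIn.1 hk).2.tail h⟩
  · exact mem_descendantsIn.2 ⟨hv, .refl⟩
  · exact fun hvw => hR.not_reflTransGen_of_rel h (mem_descendantsIn.1 hvw).2

theorem exists_top (hR : IsForest R) (hK : InducedConnected R K) (hne : K.Nonempty) :
    ∃ r ∈ K, descendantsIn R K r = K := by
  obtain ⟨r, hr, hmax⟩ := K.exists_max_image (fun v => (descendantsIn R K v).card) hne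
  have desc_of_reach {k : V} (hk : InducedReach R K r k) : ReflTransGen R k r := by
    induction hk with
    | refl => exact .refl
    | tail _ hab ih =>
      rcases hab.2.2 with hup | hdown
      · refine (hR.eq_or_reflTransGen ih hup).resolve_left ?_
        rintro rfl
        exact (hmax _ hab.2.1).not_gt (hR.card_descendantsIn_lt hab.2.1 hup)
      · exact .head hdown ih
  exact ⟨r, hr, descendantsIn_subset.antisymm fun k hk =>
    mem_descendantsIn.2 ⟨hk, desc_of_reach (hK r hr k hk)⟩⟩

/-- A lowest node with more than half of `K` below it is a centroid: each child has at most half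
of `K` below it, and the component of the parent misses everything below the node. -/
theorem exists_centroid [DecidableEq V] (hR : IsForest R) (hK : InducedConnected R K)
    (hne : K.Nonempty) :
    ∃ u ∈ K, ∀ v ∈ K.erase u, ∀ C ⊆ K.erase u,
      (∀ k ∈ C, InducedReach R (K.erase u) v k) → 2 * C.card ≤ K.card := by
  obtain ⟨r, hr, htop⟩ := hR.exists_top hK hne
  have hheavy : ∃ v ∈ K, K.card < 2 * (descendantsIn R K v).card := by
    have := hne.card_pos
    exact ⟨r, hr, by rw [htop]; omega⟩
  obtain ⟨u, hu, hmin⟩ := Finset.exists_min_image _ (fun v => (descendantsIn R K v).card)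
    (Finset.filter_nonempty_iff.2 hheavy)
  obtain ⟨huK, hlt⟩ := Finset.mem_filter.1 hu
  refine ⟨u, huK, fun v hv C hC hreach => ?_⟩
  obtain ⟨w, hw, huw, hwv⟩ :=
    hK.exists_neighbor huK (Finset.mem_of_mem_erase hv) (Finset.ne_of_mem_erase hv)
  rcases huw with huw | hwu
  · have hsub : C ⊆ K \ descendantsIn R K u := fun k hk => Finset.mem_sdiff.2
      ⟨Finset.mem_of_mem_erase (hC hk), fun hku =>
        hR.not_reflTransGen_of_reach_parent huw (hwv.trans (hreach k hk))
          (mem_descendantsIn.1 hku).2⟩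
    have := Finset.card_le_card hsub
    rw [Finset.card_sdiff_of_subset descendantsIn_subset] at this
    omega
  · have hsub : C ⊆ descendantsIn R K w := fun k hk => mem_descendantsIn.2
      ⟨Finset.mem_of_mem_erase (hC hk),
        hR.reflTransGen_of_reach_child hwu (hwv.trans (hreach k hk))⟩
    have hlight : ¬ K.card < 2 * (descendantsIn R K w).card := fun h =>
      (hmin w (Finset.mem_filter.2 ⟨Finset.mem_of_mem_erase hw, h⟩)).not_gt
        (hR.card_descendantsIn_lt huK hwu)
    have := Finset.card_le_card hsub
    omega

end IsForest

end Forest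

namespace Cost

variable {β γ : Type*}

@[simp] theorem val_op (b : β) : (op b).val = b := rfl

@[simp] theorem val_ret (b : β) : (ret b).val = b := rfl

@[simp] theorem time_ret (b : β) : (ret b).time = 0 := rfl

@[simp] theorem op_bind (b : β) (f : β → Cost γ) :
    (op b).bind f = ⟨(f b).val, 1 + (f b).time⟩ := rfl

@[simp] theorem val_bind (m : Cost β) (f : β → Cost γ) : (m.bind f).val = (f m.val).val := rfl

@[simp] theorem time_bind (m : Cost β) (f : β → Cost γ) :
    (m.bind f).time = m.time + (f m.val).time := rfl

end Cost

namespace BPE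

variable {α : Type*} [DecidableEq α]

section MergePass

variable {x y : List α} {φ C D : List (List α)}

theorem flatten_mergePass (x y : List α) (φ : List (List α)) :
    (mergePass x y φ).flatten = φ.flatten := by
  fun_induction mergePass x y φ with
  | case1 a b rest h ih => simp [ih, h.1, h.2]
  | case2 a b rest _ ih => simpa using ih
  | case3 φ _ => rfl

theorem mergePass_ne_nil (h : φ ≠ []) : mergePass x y φ ≠ [] := by
  unfold mergePass
  split
  · split <;> simp
  · exact h

theorem mem_mergePass {t : List α} (ht : t ∈ mergePass x y φ) : t ∈ φ ∨ t = x ++ y := by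
  fun_induction mergePass x y φ <;> grind

theorem mergePass_singleton (x y a : List α) : mergePass x y [a] = [a] := by
  simp [mergePass]

theorem mergePass_eq_singleton {z : List α} (h : mergePass x y φ = [z]) :
    φ = [z] ∨ φ = [x, y] ∧ z = x ++ y := by
  match φ with
  | [] => simp [mergePass] at h
  | [a] => exact .inl (by simpa [mergePass] using h)
  | a :: b :: rest =>
    rw [mergePass] at h
    split_ifs at h with hab
    · obtain ⟨rfl, hrest⟩ := List.cons_eq_cons.1 h
      obtain rfl : rest = [] := by_contra fun hne => mergePass_ne_nil hne hrest
      exact .inr ⟨by rw [hab.1, hab.2], rfl⟩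
    · exact absurd (List.cons_eq_cons.1 h).2 (mergePass_ne_nil (by simp))

theorem exists_eq_append_of_mergePass_eq_append (h : mergePass x y φ = C ++ D) :
    ∃ A B, φ = A ++ B ∧ mergePass x y A = C ∧ mergePass x y B = D := by
  rcases C with _ | ⟨c, C⟩
  · exact ⟨[], φ, rfl, by simp [mergePass], h⟩
  induction φ using mergePass.induct x y generalizing c C with
  | case1 a b rest hab ih =>
    rw [mergePass, if_pos hab, List.cons_append] at h
    obtain ⟨rfl, hrest⟩ := List.cons_eq_cons.1 h
    rcases C with _ | ⟨c, C⟩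
    · exact ⟨[a, b], rest, rfl, by simp [mergePass, hab], hrest⟩
    · obtain ⟨A, B, rfl, hA, hB⟩ := ih c C hrest
      exact ⟨a :: b :: A, B, rfl, by rw [mergePass, if_pos hab, hA], hB⟩
  | case2 a b rest hab ih =>
    rw [mergePass, if_neg hab, List.cons_append] at h
    obtain ⟨rfl, hrest⟩ := List.cons_eq_cons.1 h
    rcases C with _ | ⟨c, C⟩
    · exact ⟨[a], b :: rest, rfl, mergePass_singleton .., hrest⟩
    · obtain ⟨A, B, hAB, hA, hB⟩ := ih c C hrest
      rcases A with _ | ⟨b', A⟩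
      · simp [mergePass] at hA
      · obtain ⟨rfl, rfl⟩ := List.cons_eq_cons.1 hAB
        exact ⟨a :: b :: A, B, rfl, by rw [mergePass, if_neg hab, hA], hB⟩
  | case3 φ hφ =>
    match φ, hφ with
    | [], _ => simp [mergePass] at h
    | [a], _ =>
      rw [mergePass_singleton, List.singleton_eq_append_iff] at h
      simp only [reduceCtorEq, false_and, false_or] at h
      exact ⟨[a], [], rfl, by rw [mergePass_singleton, h.1], by simp [mergePass, h.2]⟩
    | a :: b :: rest, hφ => exact absurd rfl (hφ a b rest)

theorem mergePass_append_of_getLast?_ne {A B : List (List α)}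
    (h : (mergePass x y A).getLast? = some x → B.head? ≠ some y) :
    mergePass x y (A ++ B) = mergePass x y A ++ mergePass x y B := by
  induction A using mergePass.induct x y with
  | case1 a b rest hab ih =>
    rw [mergePass, if_pos hab] at h ⊢
    rw [List.cons_append, List.cons_append, mergePass, if_pos hab, List.cons_append,
      ih fun hx => h (by simp [List.getLast?_cons, hx])]
  | case2 a b rest hab ih =>
    rw [mergePass, if_neg hab] at h ⊢
    rw [List.cons_append, List.cons_append, mergePass, if_neg hab, List.cons_append,
      ← List.cons_append, ih fun hx => h (by simp [List.getLast?_cons, hx])]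
  | case3 A hA =>
    match A, hA, B with
    | [], _, B => simp [mergePass]
    | [a], _, [] => simp [mergePass]
    | [a], _, b :: B =>
      have hab : ¬ (a = x ∧ b = y) := by simpa [mergePass_singleton] using h
      rw [List.singleton_append, mergePass, if_neg hab, mergePass_singleton, List.singleton_append]
    | a :: b :: rest, hA, _ => exact absurd rfl (hA a b rest)

theorem mergePass_append_cons_of_eq_concat (hy : y ≠ []) {A B : List (List α)}
    (h : mergePass x y A = C ++ [x]) :
    mergePass x y (A ++ y :: B) = C ++ (x ++ y) :: mergePass x y B := by
  induction A using mergePass.induct x y generalizing C with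
  | case1 a b rest hab ih =>
    rw [mergePass, if_pos hab] at h
    rcases C with _ | ⟨c, C⟩
    · simp [hy] at h
    · obtain ⟨rfl, hrest⟩ := List.cons_eq_cons.1 h
      rw [List.cons_append, List.cons_append, mergePass, if_pos hab, ih hrest, List.cons_append]
  | case2 a b rest hab ih =>
    rw [mergePass, if_neg hab] at h
    rcases C with _ | ⟨c, C⟩
    · exact absurd (List.cons_eq_cons.1 h).2 (mergePass_ne_nil (by simp))
    · obtain ⟨rfl, hrest⟩ := List.cons_eq_cons.1 h
      rw [List.cons_append, List.cons_append, mergePass, if_neg hab, ← List.cons_append,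
        ih hrest, List.cons_append]
  | case3 A hA =>
    match A, hA with
    | [], _ => simp [mergePass] at h
    | [a], _ =>
      rw [mergePass_singleton, List.singleton_eq_append_iff] at h
      obtain ⟨rfl, rfl⟩ : C = [] ∧ x = a := by simpa using h
      simp [mergePass]
    | a :: b :: rest, hA => exact absurd rfl (hA a b rest)

end MergePass

section ApplyRules

variable {rs rs' : List (List α × List α)} {r : List α × List α} {s a b : List α}

theorem applyRules_concat (rs : List (List α × List α)) (r : List α × List α) (s : List α) :
    applyRules (rs ++ [r]) s = mergePass r.1 r.2 (applyRules rs s) := by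
  simp [applyRules]

theorem flatten_applyRules (rs : List (List α × List α)) (s : List α) :
    (applyRules rs s).flatten = s := by
  induction rs using List.reverseRecOn with
  | nil => induction s <;> simp_all [applyRules]
  | append_singleton rs r ih => rw [applyRules_concat, flatten_mergePass, ih]

theorem applyRules_ne_nil (hs : s ≠ []) : applyRules rs s ≠ [] := fun h =>
  hs (by simpa [h] using (flatten_applyRules rs s).symm)

theorem applyRules_nil_right (rs : List (List α × List α)) :
    applyRules rs ([] : List α) = [] := by
  induction rs using List.reverseRecOn with
  | nil => rfl
  | append_singleton rs r ih => rw [applyRules_concat, ih, mergePass]; simp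

theorem forall_mem_applyRules {P : List α → Prop} (hchar : ∀ c, P [c])
    (hrule : ∀ r ∈ rs, P (r.1 ++ r.2)) : ∀ t ∈ applyRules rs s, P t := by
  induction rs using List.reverseRecOn with
  | nil => simpa [applyRules] using fun c _ => hchar c
  | append_singleton rs r ih =>
    intro t ht
    rw [applyRules_concat] at ht
    rcases mem_mergePass ht with ht | rfl
    · exact ih (fun r hr => hrule r (by simp [hr])) t ht
    · exact hrule r (by simp)

theorem applyRules_eq_singleton_of_prefix {u : List α} (h : applyRules rs u = [u])
    (hrs : rs <+: rs') : applyRules rs' u = [u] := by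
  obtain ⟨l, rfl⟩ := hrs
  induction l using List.reverseRecOn with
  | nil => simpa using h
  | append_singleton l r ih => rw [← List.append_assoc, applyRules_concat, ih, mergePass_singleton]

theorem applyRules_flatten_of_eq_append {C D : List (List α)} (h : applyRules rs s = C ++ D) :
    applyRules rs C.flatten = C ∧ applyRules rs D.flatten = D := by
  induction rs using List.reverseRecOn generalizing C D with
  | nil =>
    obtain ⟨l₁, l₂, -, rfl, rfl⟩ := List.map_eq_append_iff.1 h
    have flatten_map (l : List α) : (l.map fun c => [c]).flatten = l := flatten_applyRules [] l
    rw [flatten_map, flatten_map]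
    exact ⟨rfl, rfl⟩
  | append_singleton rs r ih =>
    rw [applyRules_concat] at h
    obtain ⟨A, B, hAB, rfl, rfl⟩ := exists_eq_append_of_mergePass_eq_append h
    simp only [flatten_mergePass, applyRules_concat, ih hAB, and_self]

/-- No merge performed by the rules `rs` on `a ++ b` crosses the boundary between `a` and `b`. -/
def Splits (rs : List (List α × List α)) (a b : List α) : Prop :=
  applyRules rs (a ++ b) = applyRules rs a ++ applyRules rs b

theorem splits_of_applyRules_eq_append {C D : List (List α)} (h : applyRules rs s = C ++ D) :
    Splits rs C.flatten D.flatten := by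
  rw [Splits, (applyRules_flatten_of_eq_append h).1, (applyRules_flatten_of_eq_append h).2,
    ← List.flatten_append, ← h, flatten_applyRules]

theorem Splits.of_prefix (h : Splits rs' a b) (hrs : rs <+: rs') : Splits rs a b := by
  obtain ⟨l, rfl⟩ := hrs
  induction l using List.reverseRecOn with
  | nil => simpa using h
  | append_singleton l r ih =>
    apply ih
    rw [← List.append_assoc, Splits, applyRules_concat, applyRules_concat, applyRules_concat] at h
    obtain ⟨A, B, hAB, hA, hB⟩ := exists_eq_append_of_mergePass_eq_append h
    have hA' : A.flatten = a := by
      rw [← flatten_mergePass r.1 r.2, hA, flatten_mergePass, flatten_applyRules]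
    have hB' : B.flatten = b := by
      rw [← flatten_mergePass r.1 r.2, hB, flatten_mergePass, flatten_applyRules]
    exact hA' ▸ hB' ▸ splits_of_applyRules_eq_append hAB

theorem Splits.applyRules_concat_of_merge (hr : r.2 ≠ []) (h : Splits rs a b)
    {C D : List (List α)} (ha : applyRules (rs ++ [r]) a = C ++ [r.1])
    (hb : applyRules rs b = r.2 :: D) :
    applyRules (rs ++ [r]) (a ++ b) = C ++ (r.1 ++ r.2) :: mergePass r.1 r.2 D := by
  rw [applyRules_concat] at ha ⊢
  rw [h, hb, mergePass_append_cons_of_eq_concat hr ha]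

theorem Splits.concat_iff (hr : r.2 ≠ []) (h : Splits rs a b) :
    Splits (rs ++ [r]) a b ↔
      ¬ ((applyRules (rs ++ [r]) a).getLast? = some r.1 ∧
        (applyRules rs b).head? = some r.2) := by
  constructor
  · rintro hs ⟨ha, hb⟩
    obtain ⟨C, hC⟩ := List.getLast?_eq_some_iff.1 ha
    obtain ⟨D, hD⟩ := List.head?_eq_some_iff.1 hb
    have hmerge := h.applyRules_concat_of_merge hr hC hD
    rw [hs, hC, List.append_assoc] at hmerge
    simpa [hr] using List.append_cancel_left hmerge
  · rw [applyRules_concat]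
    intro hn
    rw [Splits, applyRules_concat, applyRules_concat, applyRules_concat, h,
      mergePass_append_of_getLast?_ne fun ha hb => hn ⟨ha, hb⟩]

/-- Whether a merge crosses a boundary depends on the left side only through its last token. -/
theorem Splits.append_left {e p w : List α} (hep : Splits rs e p) (hpw : Splits rs p w)
    (hp : p ≠ []) (hrs : ∀ r ∈ rs, r.2 ≠ []) : Splits rs (e ++ p) w := by
  induction rs using List.reverseRecOn with
  | nil => simp [Splits, applyRules]
  | append_singleton rs r ih =>
    have hprefix : rs <+: rs ++ [r] := List.prefix_append ..
    have hr : r.2 ≠ [] := hrs r (by simp)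
    have hsplits : Splits rs (e ++ p) w :=
      ih (hep.of_prefix hprefix) (hpw.of_prefix hprefix) fun r hr => hrs r (by simp [hr])
    rw [hsplits.concat_iff hr, hep, List.getLast?_append_of_ne_nil _ (applyRules_ne_nil hp)]
    exact ((hpw.of_prefix hprefix).concat_iff hr).1 hpw

/-- The last token of `s` after the rules `rs` (`[]` for the empty string): the stages of the
computation of `BPE.lastToken`. -/
def lastTokenAfter (rs : List (List α × List α)) (s : List α) : List α :=
  (applyRules rs s).getLastD []

theorem lastTokenAfter_nil (rs : List (List α × List α)) :
    lastTokenAfter rs ([] : List α) = [] := by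
  rw [lastTokenAfter, applyRules_nil_right, List.getLastD_nil]

theorem lastTokenAfter_eq_of_eq_concat {u : List α} {E : List (List α)}
    (h : applyRules rs s = E ++ [u]) : lastTokenAfter rs s = u := by
  rw [lastTokenAfter, h, List.getLastD_concat]

theorem exists_applyRules_eq_concat (hs : s ≠ []) :
    ∃ E, applyRules rs s = E ++ [lastTokenAfter rs s] := by
  obtain ⟨E, u, hE⟩ := (List.eq_nil_or_concat' _).resolve_left (applyRules_ne_nil (rs := rs) hs)
  exact ⟨E, by rw [lastTokenAfter_eq_of_eq_concat hE, hE]⟩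

theorem exists_eq_append_lastTokenAfter (rs : List (List α × List α)) (hs : s ≠ []) :
    ∃ e, s = e ++ lastTokenAfter rs s ∧ Splits rs e (lastTokenAfter rs s) ∧
      applyRules rs (lastTokenAfter rs s) = [lastTokenAfter rs s] := by
  obtain ⟨E, hE⟩ := exists_applyRules_eq_concat (rs := rs) hs
  have hflatten : [lastTokenAfter rs s].flatten = lastTokenAfter rs s := List.flatten_singleton
  refine ⟨E.flatten, ?_, ?_, ?_⟩
  · have hs' := flatten_applyRules rs s
    rw [hE, List.flatten_append, hflatten] at hs'
    exact hs'.symm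
  · simpa only [hflatten] using splits_of_applyRules_eq_append hE
  · simpa only [hflatten] using (applyRules_flatten_of_eq_append hE).2

theorem lastTokenAfter_suffix (rs : List (List α × List α)) (s : List α) :
    lastTokenAfter rs s <:+ s := by
  rcases eq_or_ne s [] with rfl | hs
  · rw [lastTokenAfter_nil]
  · obtain ⟨e, he, -⟩ := exists_eq_append_lastTokenAfter rs hs
    exact ⟨e, he.symm⟩

theorem Splits.lastTokenAfter_append (h : Splits rs a b) (hb : b ≠ []) :
    lastTokenAfter rs (a ++ b) = lastTokenAfter rs b := by
  obtain ⟨E, hE⟩ := exists_applyRules_eq_concat (rs := rs) hb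
  exact lastTokenAfter_eq_of_eq_concat (E := applyRules rs a ++ E)
    (by rw [h, List.append_assoc, ← hE])

theorem lastTokenAfter_eq_self {u : List α} (h : applyRules rs u = [u]) :
    lastTokenAfter rs u = u :=
  lastTokenAfter_eq_of_eq_concat (E := []) h

theorem lastTokenAfter_eq_of_prefix (hs : s ≠ []) (hrs : rs <+: rs')
    (h : applyRules rs (lastTokenAfter rs' s) = [lastTokenAfter rs' s]) :
    lastTokenAfter rs s = lastTokenAfter rs' s := by
  obtain ⟨e, he, hsplits, hself⟩ := exists_eq_append_lastTokenAfter rs' hs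
  have hne : lastTokenAfter rs' s ≠ [] := by
    intro hnil
    rw [hnil, applyRules_nil_right] at hself
    exact List.cons_ne_nil _ _ hself.symm
  conv_lhs => rw [he]
  rw [(hsplits.of_prefix hrs).lastTokenAfter_append hne, lastTokenAfter_eq_self h]

theorem lastTokenAfter_concat (rs : List (List α × List α)) (r : List α × List α)
    (s : List α) :
    lastTokenAfter (rs ++ [r]) s = lastTokenAfter rs s ∨
      lastTokenAfter (rs ++ [r]) s = r.1 ++ r.2 ∧ lastTokenAfter rs s = r.2 ∧
        applyRules rs (r.1 ++ r.2) = [r.1, r.2] := by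
  rcases eq_or_ne s [] with rfl | hs
  · simp only [lastTokenAfter_nil, true_or]
  have hprefix : rs <+: rs ++ [r] := List.prefix_append ..
  obtain ⟨e, he, hsplits, hself⟩ := exists_eq_append_lastTokenAfter (rs ++ [r]) hs
  have hself' := hself
  rw [applyRules_concat] at hself'
  rcases mergePass_eq_singleton hself' with hsingle | ⟨hpair, hu⟩
  · exact .inl (lastTokenAfter_eq_of_prefix hs hprefix hsingle).symm
  · rw [hu] at he hsplits hpair
    have hne : r.1 ++ r.2 ≠ [] := by
      intro hnil
      rw [hnil, applyRules_nil_right] at hpair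
      exact List.cons_ne_nil _ _ hpair.symm
    refine .inr ⟨hu, ?_, hpair⟩
    rw [he, (hsplits.of_prefix hprefix).lastTokenAfter_append hne]
    exact lastTokenAfter_eq_of_eq_concat (E := [r.1]) hpair

end ApplyRules

section CanonicalRules

variable {B : BPE α} {u v w : List α} {j k : ℕ}

theorem lastTokenAfter_rules (B : BPE α) (s : List α) :
    lastTokenAfter B.rules s = B.lastToken s := rfl

theorem snd_ne_nil_of_mem_rules {α : Type*} {B : BPE α} {r : List α × List α}
    (hr : r ∈ B.rules) : r.2 ≠ [] := fun h =>
  B.nil_notMem (h ▸ (B.rules_mem r hr).2.1)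

theorem ne_nil_of_mem_canon (hu : u ∈ B.canon) : u ≠ [] := fun h =>
  B.nil_notMem (h ▸ (Finset.mem_filter.1 hu).1)

theorem applyRules_eq_singleton_of_mem_canon (hu : u ∈ B.canon) : applyRules B.rules u = [u] :=
  (Finset.mem_filter.1 hu).2

theorem mem_canon_of_applyRules_take (h : applyRules (B.rules.take k) u = [u]) : u ∈ B.canon := by
  have hvocab : ∀ t ∈ applyRules (B.rules.take k) u, t ∈ B.vocab :=
    forall_mem_applyRules B.atomic_mem fun r hr => (B.rules_mem r (List.mem_of_mem_take hr)).2.2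
  exact Finset.mem_filter.2 ⟨hvocab u (by simp [h]),
    applyRules_eq_singleton_of_prefix h (List.take_prefix ..)⟩

theorem lastToken_of_mem_canon (hu : u ∈ B.canon) : B.lastToken u = u :=
  lastTokenAfter_eq_self (applyRules_eq_singleton_of_mem_canon hu)

theorem lastToken_mem_canon (B : BPE α) {s : List α} (hs : s ≠ []) : B.lastToken s ∈ B.canon := by
  obtain ⟨-, -, -, hself⟩ := exists_eq_append_lastTokenAfter B.rules hs
  exact mem_canon_of_applyRules_take (k := B.rules.length) (by rwa [List.take_length])

theorem lastToken_suffix (B : BPE α) (s : List α) : B.lastToken s <:+ s :=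
  lastTokenAfter_suffix B.rules s

theorem ruleIdx_lt_iff (hu : u ∈ B.canon) (hlen : 1 < u.length) :
    B.ruleIdx u < j ↔ applyRules (B.rules.take j) u = [u] := by
  have hzero : applyRules (B.rules.take 0) u ≠ [u] := fun h => by
    have := congrArg List.length h
    simp [applyRules] at this
    omega
  have hfull := applyRules_eq_singleton_of_mem_canon hu
  have hpos : B.rules.length ≠ 0 := fun h =>
    hzero (by simpa [List.length_eq_zero_iff.1 h] using hfull)
  obtain ⟨k, hk⟩ : ∃ k, ((List.range B.rules.length).find? fun k =>
      decide (applyRules (B.rules.take (k + 1)) u = [u])) = some k := by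
    rw [← Option.isSome_iff_exists, List.find?_isSome]
    refine ⟨B.rules.length - 1, by simp; omega, ?_⟩
    rw [Nat.sub_add_cancel (by omega), List.take_length]
    simpa using hfull
  have hidx : B.ruleIdx u = k := by rw [ruleIdx, hk]; rfl
  rw [List.find?_range_eq_some] at hk
  obtain ⟨hself, -, hfirst⟩ := hk
  rw [hidx]
  constructor
  · exact fun hkj => applyRules_eq_singleton_of_prefix (by simpa using hself)
      (List.take_prefix_take_left hkj)
  · intro hj
    by_contra hjk
    cases j with
    | zero => exact hzero hj
    | succ j => simpa [hj] using hfirst j (by omega)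

namespace SucEdge

theorem ruleIdx_lt_iff (h : B.SucEdge u v) :
    B.ruleIdx u < j ↔ applyRules (B.rules.take j) u = [u] :=
  BPE.ruleIdx_lt_iff h.1 h.2.1

theorem ruleIdx_lt_length (h : B.SucEdge u v) : B.ruleIdx u < B.rules.length := by
  rw [h.ruleIdx_lt_iff, List.take_length]
  exact applyRules_eq_singleton_of_mem_canon h.1

theorem rules_ruleIdx (h : B.SucEdge u v) :
    B.rules[B.ruleIdx u]'h.ruleIdx_lt_length = (B.pre u, v) := by
  have hsuc : B.suc u = v := h.2.2
  rw [suc, if_pos ⟨h.1, h.2.1⟩, List.getD_eq_getElem _ _ h.ruleIdx_lt_length] at hsuc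
  refine Prod.ext ?_ hsuc
  rw [pre, if_pos ⟨h.1, h.2.1⟩, List.getD_eq_getElem _ _ h.ruleIdx_lt_length]

theorem take_succ_ruleIdx (h : B.SucEdge u v) :
    B.rules.take (B.ruleIdx u + 1) = B.rules.take (B.ruleIdx u) ++ [(B.pre u, v)] := by
  rw [List.take_succ_eq_append_getElem h.ruleIdx_lt_length, h.rules_ruleIdx]

theorem applyRules_ruleIdx_and_pre_append (h : B.SucEdge u v) :
    applyRules (B.rules.take (B.ruleIdx u)) u = [B.pre u, v] ∧ u = B.pre u ++ v := by
  have hafter := h.ruleIdx_lt_iff.1 (B.ruleIdx u).lt_succ_self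
  rw [Nat.succ_eq_add_one, h.take_succ_ruleIdx, applyRules_concat] at hafter
  exact (mergePass_eq_singleton hafter).resolve_left fun hbefore =>
    lt_irrefl _ (h.ruleIdx_lt_iff.2 hbefore)

theorem applyRules_ruleIdx (h : B.SucEdge u v) :
    applyRules (B.rules.take (B.ruleIdx u)) u = [B.pre u, v] :=
  h.applyRules_ruleIdx_and_pre_append.1

theorem pre_append (h : B.SucEdge u v) : B.pre u ++ v = u :=
  h.applyRules_ruleIdx_and_pre_append.2.symm

theorem applyRules_pre (h : B.SucEdge u v) :
    applyRules (B.rules.take (B.ruleIdx u)) (B.pre u) = [B.pre u] := by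
  simpa using (applyRules_flatten_of_eq_append (C := [B.pre u]) (D := [v]) h.applyRules_ruleIdx).1

theorem applyRules_right (h : B.SucEdge u v) :
    applyRules (B.rules.take (B.ruleIdx u)) v = [v] := by
  simpa using (applyRules_flatten_of_eq_append (C := [B.pre u]) (D := [v]) h.applyRules_ruleIdx).2

theorem splits (h : B.SucEdge u v) : Splits (B.rules.take (B.ruleIdx u)) (B.pre u) v := by
  rw [Splits, h.pre_append, h.applyRules_ruleIdx, h.applyRules_pre, h.applyRules_right,
    List.singleton_append]

theorem pre_mem_canon (h : B.SucEdge u v) : B.pre u ∈ B.canon :=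
  mem_canon_of_applyRules_take h.applyRules_pre

theorem right_mem_canon (h : B.SucEdge u v) : v ∈ B.canon :=
  mem_canon_of_applyRules_take h.applyRules_right

theorem suffix (h : B.SucEdge u v) : v <:+ u := ⟨_, h.pre_append⟩

theorem length_lt (h : B.SucEdge u v) : v.length < u.length := by
  have hpre := List.length_pos_iff.2 (ne_nil_of_mem_canon h.pre_mem_canon)
  rw [← h.pre_append, List.length_append]
  omega

end SucEdge

theorem sucEdge_of_applyRules_take {x y : List α} (hk : k < B.rules.length)
    (hrule : B.rules[k] = (x, y)) (h : applyRules (B.rules.take k) (x ++ y) = [x, y]) :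
    B.SucEdge (x ++ y) y ∧ B.ruleIdx (x ++ y) = k := by
  have hsingle : applyRules (B.rules.take (k + 1)) (x ++ y) = [x ++ y] := by
    rw [List.take_succ_eq_append_getElem hk, applyRules_concat, h, hrule]
    simp [mergePass]
  have hmem := mem_canon_of_applyRules_take hsingle
  have hlen : 1 < (x ++ y).length := by
    obtain ⟨hx, hy, -⟩ := B.rules_mem (x, y) (hrule ▸ List.getElem_mem hk)
    have hx' : 0 < x.length := List.length_pos_iff.2 (ne_of_mem_of_not_mem hx B.nil_notMem)
    have hy' : 0 < y.length := List.length_pos_iff.2 (ne_of_mem_of_not_mem hy B.nil_notMem)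
    rw [List.length_append]
    omega
  have hedge : B.SucEdge (x ++ y) (B.suc (x ++ y)) := ⟨hmem, hlen, rfl⟩
  have hidx : B.ruleIdx (x ++ y) = k := by
    refine le_antisymm (Nat.lt_succ_iff.1 (hedge.ruleIdx_lt_iff.2 hsingle)) (not_lt.1 fun hlt => ?_)
    rw [hedge.ruleIdx_lt_iff, h] at hlt
    simp at hlt
  have hrule' := hedge.rules_ruleIdx
  simp only [hidx, hrule, Prod.mk.injEq] at hrule'
  exact ⟨⟨hmem, hlen, hrule'.2.symm⟩, hidx⟩

/-- `u` is a descendant of `v` in the successor forest, possibly `v` itself. -/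
abbrev Desc (B : BPE α) (u v : List α) : Prop := Relation.ReflTransGen B.SucEdge u v

theorem Desc.suffix (h : B.Desc u v) : v <:+ u :=
  h.rec List.suffix_rfl fun _ hvw ih => hvw.suffix.trans ih

theorem exists_desc_singleton (hu : u ∈ B.canon) : ∃ c, B.Desc u [c] := by
  induction hn : u.length using Nat.strong_induction_on generalizing u with
  | _ n ih =>
    by_cases hlen : 1 < u.length
    · have hedge : B.SucEdge u (B.suc u) := ⟨hu, hlen, rfl⟩
      obtain ⟨c, hc⟩ := ih _ (hn ▸ hedge.length_lt) hedge.right_mem_canon rfl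
      exact ⟨c, hc.head hedge⟩
    · have hpos := List.length_pos_iff.2 (ne_nil_of_mem_canon hu)
      obtain ⟨c, rfl⟩ := List.length_eq_one_iff.1 (show u.length = 1 by omega)
      exact ⟨c, .refl⟩

end CanonicalRules

section LastToken

variable {B : BPE α} {s u v p : List α} {j k : ℕ}

theorem lastTokenAfter_take_succ (B : BPE α) (k : ℕ) (s : List α) :
    lastTokenAfter (B.rules.take (k + 1)) s = lastTokenAfter (B.rules.take k) s ∨
      B.SucEdge (lastTokenAfter (B.rules.take (k + 1)) s)
        (lastTokenAfter (B.rules.take k) s) := by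
  by_cases hk : k < B.rules.length
  · rw [List.take_succ_eq_append_getElem hk]
    refine (lastTokenAfter_concat _ B.rules[k] s).imp_right fun ⟨hu, hv, hpair⟩ => ?_
    rw [hu, hv]
    exact (sucEdge_of_applyRules_take hk rfl hpair).1
  · rw [List.take_of_length_le (by omega), List.take_of_length_le (by omega)]
    exact .inl rfl

theorem desc_lastTokenAfter_take (B : BPE α) (s : List α) (hjk : j ≤ k) :
    B.Desc (lastTokenAfter (B.rules.take k) s) (lastTokenAfter (B.rules.take j) s) := by
  induction hjk with
  | refl => exact .refl
  | @step k _ ih =>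
    rcases B.lastTokenAfter_take_succ k s with h | h
    · rwa [Nat.succ_eq_add_one, h]
    · exact ih.head h

theorem desc_lastToken_lastTokenAfter_take (B : BPE α) (s : List α) (j : ℕ) :
    B.Desc (B.lastToken s) (lastTokenAfter (B.rules.take j) s) := by
  have := B.desc_lastTokenAfter_take s (le_max_left j B.rules.length)
  rwa [List.take_of_length_le (le_max_right _ _)] at this

theorem SucEdge.lastTokenAfter_take_ruleIdx (h : B.SucEdge u v)
    (hu : lastTokenAfter (B.rules.take j) s = u) :
    B.ruleIdx u < j ∧ lastTokenAfter (B.rules.take (B.ruleIdx u + 1)) s = u ∧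
      lastTokenAfter (B.rules.take (B.ruleIdx u)) s = v := by
  have hs : s ≠ [] := by
    rintro rfl
    rw [lastTokenAfter_nil] at hu
    exact ne_nil_of_mem_canon h.1 hu.symm
  obtain ⟨e, he, hsplits, hself⟩ := exists_eq_append_lastTokenAfter (B.rules.take j) hs
  rw [hu] at he hsplits hself
  have hlt : B.ruleIdx u < j := h.ruleIdx_lt_iff.2 hself
  refine ⟨hlt, ?_, ?_⟩
  · rw [he, (hsplits.of_prefix (List.take_prefix_take_left hlt)).lastTokenAfter_append
      (ne_nil_of_mem_canon h.1), lastTokenAfter_eq_self (h.ruleIdx_lt_iff.1 (Nat.lt_succ_self _))]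
  · rw [he, (hsplits.of_prefix (List.take_prefix_take_left hlt.le)).lastTokenAfter_append
      (ne_nil_of_mem_canon h.1)]
    exact lastTokenAfter_eq_of_eq_concat (E := [B.pre u]) h.applyRules_ruleIdx

theorem desc_lastToken_iff_exists_take :
    B.Desc (B.lastToken s) u ↔ ∃ j, lastTokenAfter (B.rules.take j) s = u := by
  constructor
  · intro h
    induction h with
    | refl => exact ⟨B.rules.length, by rw [List.take_length, lastTokenAfter_rules]⟩
    | tail _ hedge ih =>
      obtain ⟨j, hj⟩ := ih
      exact ⟨_, (hedge.lastTokenAfter_take_ruleIdx hj).2.2⟩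
  · rintro ⟨j, rfl⟩
    exact B.desc_lastToken_lastTokenAfter_take s j

theorem SucEdge.desc_lastToken_iff (h : B.SucEdge u v) :
    B.Desc (B.lastToken s) u ↔ lastTokenAfter (B.rules.take (B.ruleIdx u + 1)) s = u := by
  rw [desc_lastToken_iff_exists_take]
  exact ⟨fun ⟨_, hj⟩ => (h.lastTokenAfter_take_ruleIdx hj).2.1, fun hu => ⟨_, hu⟩⟩

theorem lastTokenAfter_take_eq_iff (hp : applyRules (B.rules.take j) p = [p]) :
    lastTokenAfter (B.rules.take j) s = p ↔
      B.lastToken s = p ∨ ∃ v, B.SucEdge v p ∧ B.Desc (B.lastToken s) v ∧ j ≤ B.ruleIdx v := by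
  have eq_of_prefix {rs : List (List α × List α)} (hrs : B.rules.take j <+: rs)
      (h : lastTokenAfter rs s = p) : lastTokenAfter (B.rules.take j) s = p := by
    have hs : s ≠ [] := by
      rintro rfl
      rw [lastTokenAfter_nil] at h
      exact ne_nil_of_mem_canon (mem_canon_of_applyRules_take hp) h.symm
    rw [lastTokenAfter_eq_of_prefix hs hrs (by rw [h, hp]), h]
  constructor
  · rintro h
    have hdesc : B.Desc (B.lastToken s) p := h ▸ B.desc_lastToken_lastTokenAfter_take s j
    rcases hdesc.cases_tail with hp | ⟨v, hv, hvp⟩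
    · exact .inl hp.symm
    refine .inr ⟨v, hvp, hv, not_lt.1 fun hlt => hvp.length_lt.not_ge ?_⟩
    have hback := B.desc_lastTokenAfter_take s hlt
    rw [h, Nat.succ_eq_add_one, hvp.desc_lastToken_iff.1 hv] at hback
    exact hback.suffix.length_le
  · rintro (h | ⟨v, hvp, hv, hle⟩)
    · exact eq_of_prefix (List.take_prefix ..) h
    · exact eq_of_prefix (List.take_prefix_take_left hle)
        (hvp.lastTokenAfter_take_ruleIdx (hvp.desc_lastToken_iff.1 hv)).2.2

namespace SucEdge

theorem splits_of_lastTokenAfter_append_eq (h : B.SucEdge u v)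
    (hu : lastTokenAfter (B.rules.take (B.ruleIdx u + 1)) (s ++ v) = u) :
    Splits (B.rules.take (B.ruleIdx u)) s v := by
  have hne : s ++ v ≠ [] := fun hnil => ne_nil_of_mem_canon h.right_mem_canon
    (List.append_eq_nil_iff.1 hnil).2
  obtain ⟨e, he, hsplits, -⟩ :=
    exists_eq_append_lastTokenAfter (B.rules.take (B.ruleIdx u + 1)) hne
  rw [hu] at he hsplits
  have hs : s = e ++ B.pre u := by
    rw [← h.pre_append, ← List.append_assoc] at he
    exact List.append_cancel_right he
  have hseq : applyRules (B.rules.take (B.ruleIdx u)) (s ++ v) =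
      (applyRules (B.rules.take (B.ruleIdx u)) e ++ [B.pre u]) ++ [v] := by
    rw [he, hsplits.of_prefix (List.take_prefix_take_left (Nat.le_succ _)), h.applyRules_ruleIdx]
    simp
  have := splits_of_applyRules_eq_append hseq
  simpa only [List.flatten_append, flatten_applyRules, List.flatten_singleton, ← hs] using this

/-- Just before `u` forms at the end of `s ++ v`, nothing has merged across the boundary in front
of `v`, so the predecessor of `u` is there if and only if it is the last token of `s` alone. -/
theorem lastTokenAfter_append_eq_iff (h : B.SucEdge u v) :
    lastTokenAfter (B.rules.take (B.ruleIdx u + 1)) (s ++ v) = u ↔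
      lastTokenAfter (B.rules.take (B.ruleIdx u + 1)) s = B.pre u := by
  have hv := ne_nil_of_mem_canon h.right_mem_canon
  have hpre := ne_nil_of_mem_canon h.pre_mem_canon
  constructor
  · intro hu
    by_contra hne
    have hsplits : Splits (B.rules.take (B.ruleIdx u + 1)) s v := by
      rw [h.take_succ_ruleIdx, (h.splits_of_lastTokenAfter_append_eq hu).concat_iff hv,
        ← h.take_succ_ruleIdx]
      rintro ⟨hlast, -⟩
      obtain ⟨E, hE⟩ := List.getLast?_eq_some_iff.1 hlast
      exact hne (lastTokenAfter_eq_of_eq_concat hE)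
    rw [hsplits.lastTokenAfter_append hv, lastTokenAfter_eq_self
      (applyRules_eq_singleton_of_prefix h.applyRules_right
        (List.take_prefix_take_left (Nat.le_succ _)))] at hu
    exact h.length_lt.ne (congrArg List.length hu)
  · intro hlast
    have hs : s ≠ [] := by
      rintro rfl
      exact hpre (hlast.symm.trans (lastTokenAfter_nil _))
    obtain ⟨e, he, hep, -⟩ :=
      exists_eq_append_lastTokenAfter (B.rules.take (B.ruleIdx u + 1)) hs
    obtain ⟨E, hE⟩ := exists_applyRules_eq_concat (rs := B.rules.take (B.ruleIdx u + 1)) hs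
    rw [hlast] at he hep hE
    have hsplits : Splits (B.rules.take (B.ruleIdx u)) s v := he ▸
      (hep.of_prefix (List.take_prefix_take_left (Nat.le_succ _))).append_left h.splits hpre
        fun r hr => snd_ne_nil_of_mem_rules (List.mem_of_mem_take hr)
    rw [h.take_succ_ruleIdx] at hE ⊢
    apply lastTokenAfter_eq_of_eq_concat (E := E)
    rw [hsplits.applyRules_concat_of_merge (r := (B.pre u, v)) hv hE h.applyRules_right,
      h.pre_append]
    rfl

theorem desc_lastToken_append_iff (h : B.SucEdge u v) :
    B.Desc (B.lastToken (s ++ v)) u ↔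
      B.lastToken s = B.pre u ∨
      ∃ w, B.SucEdge w (B.pre u) ∧ B.Desc (B.lastToken s) w ∧ B.ruleIdx u < B.ruleIdx w := by
  rw [h.desc_lastToken_iff, h.lastTokenAfter_append_eq_iff,
    lastTokenAfter_take_eq_iff (applyRules_eq_singleton_of_prefix h.applyRules_pre
      (List.take_prefix_take_left (Nat.le_succ _)))]
  rfl

end SucEdge

end LastToken

theorem isForest_sucEdge (B : BPE α) : IsForest B.SucEdge where
  rightUnique _ _ _ h h' := h.2.2.symm.trans h'.2.2
  acyclic u h := by
    obtain ⟨v, huv, hvu⟩ := Relation.TransGen.head'_iff.1 h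
    exact huv.length_lt.not_ge (Desc.suffix hvu).length_le

section Preorder

variable {B : BPE α} {u v w : List α} {f : ℕ} {order : List α}

theorem length_le_maxLen (hu : u ∈ B.canon) : u.length ≤ B.maxLen :=
  Finset.le_sup (f := List.length) hu

theorem mem_childrenByPriority : v ∈ B.childrenByPriority u ↔ B.SucEdge v u := by
  simp only [childrenByPriority, List.mem_filterMap, List.mem_reverse, List.mem_range]
  constructor
  · rintro ⟨k, -, hk⟩
    split_ifs at hk with hedge
    obtain rfl := Option.some.inj hk
    exact hedge.2
  · intro h
    have happend : (B.rules.getD (B.ruleIdx v) ([], [])).1 ++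
        (B.rules.getD (B.ruleIdx v) ([], [])).2 = v := by
      rw [List.getD_eq_getElem _ _ h.ruleIdx_lt_length, h.rules_ruleIdx, h.pre_append]
    refine ⟨B.ruleIdx v, h.ruleIdx_lt_length, ?_⟩
    simp only [happend, h, and_self, if_true]

theorem childrenByPriority_pairwise (B : BPE α) (u : List α) :
    (B.childrenByPriority u).Pairwise fun v w => B.ruleIdx w < B.ruleIdx v := by
  rw [childrenByPriority, List.pairwise_filterMap, List.pairwise_reverse]
  refine List.pairwise_lt_range.imp fun {j k} hjk v hv w hw => ?_
  simp only at hv hw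
  split_ifs at hv with hk
  split_ifs at hw with hj
  obtain rfl := Option.some.inj hv
  obtain rfl := Option.some.inj hw
  rwa [hk.1, hj.1]

theorem childrenByPriority_nodup (B : BPE α) (u : List α) : (B.childrenByPriority u).Nodup :=
  (B.childrenByPriority_pairwise u).imp fun h hvw => h.ne (congrArg _ hvw.symm)

theorem desc_of_mem_preorderAux (h : w ∈ B.preorderAux f u) : B.Desc w u := by
  induction f generalizing u with
  | zero =>
    obtain rfl : w = u := by simpa [preorderAux] using h
    exact .refl
  | succ f ih =>
    rw [preorderAux, List.mem_cons, List.mem_flatMap] at h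
    rcases h with rfl | ⟨v, hv, hw⟩
    · exact .refl
    · exact .tail (ih hw) (mem_childrenByPriority.1 hv)

theorem mem_preorderAux_of_desc (h : B.Desc w u) (hf : w.length ≤ f + u.length) :
    w ∈ B.preorderAux f u := by
  induction f generalizing u with
  | zero =>
    rw [preorderAux, List.mem_singleton]
    exact (h.suffix.eq_of_length_le (by omega)).symm
  | succ f ih =>
    rw [preorderAux, List.mem_cons, List.mem_flatMap]
    refine h.cases_tail.imp Eq.symm fun ⟨v, hwv, hvu⟩ => ?_
    have := hvu.length_lt
    exact ⟨v, mem_childrenByPriority.2 hvu, ih hwv (by omega)⟩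

theorem mem_preorder : w ∈ B.preorder u ↔ B.Desc w u := by
  refine ⟨desc_of_mem_preorderAux, fun h => mem_preorderAux_of_desc h ?_⟩
  rcases h.cases_head with rfl | ⟨v, hwv, -⟩
  · omega
  · have := length_le_maxLen hwv.1
    omega

theorem preorderAux_succ (h : B.maxLen ≤ f + u.length) :
    B.preorderAux (f + 1) u = B.preorderAux f u := by
  induction f generalizing u with
  | zero =>
    have hleaf : B.childrenByPriority u = [] := by
      refine List.eq_nil_iff_forall_not_mem.2 fun v hv => ?_
      have hedge := mem_childrenByPriority.1 hv
      have := length_le_maxLen hedge.1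
      have := hedge.length_lt
      omega
    simp [preorderAux, hleaf]
  | succ f ih =>
    rw [preorderAux, preorderAux]
    congr 1
    refine List.flatMap_congr fun v hv => ih ?_
    have := (mem_childrenByPriority.1 hv).length_lt
    omega

theorem preorder_eq (B : BPE α) (u : List α) :
    B.preorder u = u :: (B.childrenByPriority u).flatMap B.preorder := by
  rw [preorder, ← preorderAux_succ (by omega), preorderAux]
  rfl

theorem preorderAux_nodup (B : BPE α) (f : ℕ) (u : List α) : (B.preorderAux f u).Nodup := by
  induction f generalizing u with
  | zero => simp [preorderAux]
  | succ f ih =>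
    rw [preorderAux, List.nodup_cons, List.nodup_flatMap]
    refine ⟨fun hu => ?_, fun v _ => ih v, ?_⟩
    · obtain ⟨v, hv, huv⟩ := List.mem_flatMap.1 hu
      exact B.isForest_sucEdge.not_reflTransGen_of_rel (mem_childrenByPriority.1 hv)
        (desc_of_mem_preorderAux huv)
    · refine (B.childrenByPriority_nodup u).imp_of_mem fun hv hw hne k hkv hkw => hne ?_
      exact B.isForest_sucEdge.sibling_unique (mem_childrenByPriority.1 hv)
        (mem_childrenByPriority.1 hw) (desc_of_mem_preorderAux hkv) (desc_of_mem_preorderAux hkw)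

theorem forestOrder_nodup (B : BPE α) (hnodup : order.Nodup) : (B.forestOrder order).Nodup := by
  rw [forestOrder, List.nodup_flatMap]
  refine ⟨fun c _ => B.preorderAux_nodup _ _, hnodup.imp fun {c d} hne k hkc hkd => hne ?_⟩
  have hcd : [c] <:+ [d] := List.suffix_of_suffix_length_le (mem_preorder.1 hkc).suffix
    (mem_preorder.1 hkd).suffix le_rfl
  simpa using hcd.eq_of_length rfl

theorem Desc.preorder_infix (h : B.Desc u v) : B.preorder u <:+: B.preorder v := by
  induction h with
  | refl => exact List.infix_rfl
  | @tail v w _ hvw ih =>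
    rw [B.preorder_eq w]
    exact ih.trans <| (List.infix_flatMap_of_mem (mem_childrenByPriority.2 hvw) _).trans
      (List.suffix_cons _ _).isInfix

theorem preorder_infix_forestOrder (hall : ∀ c, c ∈ order) (hu : u ∈ B.canon) :
    B.preorder u <:+: B.forestOrder order := by
  obtain ⟨c, hc⟩ := exists_desc_singleton hu
  exact hc.preorder_infix.trans
    (List.infix_of_mem_flatten (List.mem_map_of_mem (f := fun c => B.preorder [c]) (hall c)))

theorem eq_of_dfsIn_eq (hall : ∀ c, c ∈ order) (hu : u ∈ B.canon)
    (h : B.dfsIn order u = B.dfsIn order v) : u = v :=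
  (List.idxOf_inj ((preorder_infix_forestOrder hall hu).subset (mem_preorder.2 .refl))).1 h

theorem dfsIn_eq_length_of_forestOrder_eq (hnodup : order.Nodup) {P S : List (List α)}
    (h : B.forestOrder order = P ++ v :: S) : B.dfsIn order v = P.length := by
  have hsplit := h ▸ B.forestOrder_nodup hnodup
  rw [dfsIn, h, List.idxOf_append_of_notMem fun hv =>
    (List.nodup_append'.1 hsplit).2.2 hv (List.mem_cons_self ..), List.idxOf_cons_self, add_zero]

end Preorder

section Intervals

variable {B : BPE α} {order : List α} {s t u v w k : List α}

/-- The timestamp `x` lies in the valid interval of `t`. -/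
def InInterval (B : BPE α) (order t : List α) (x : ℕ) : Prop :=
  B.intervalL order t ≤ x ∧ x < B.intervalR order t

/-- The children of `pre t` are visited in order of increasing priority, so those with a priority
below that of `t` come first. -/
theorem SucEdge.exists_segment (hnodup : order.Nodup) (hall : ∀ c, c ∈ order)
    (h : B.SucEdge t v) :
    ∃ P Q S, B.forestOrder order = P ++ Q ++ S ∧
      B.intervalL order t = P.length ∧ B.intervalR order t = P.length + Q.length ∧
      Q = B.pre t :: ((B.childrenByPriority (B.pre t)).filter
        fun w => B.ruleIdx t < B.ruleIdx w).flatMap B.preorder := by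
  obtain ⟨P, S, hPS⟩ := preorder_infix_forestOrder hall h.pre_mem_canon
  have hL : B.intervalL order t = P.length := by
    rw [B.preorder_eq] at hPS
    exact dfsIn_eq_length_of_forestOrder_eq hnodup (by rw [← hPS, List.append_assoc]; rfl)
  set l := B.childrenByPriority (B.pre t) with hl
  set p : List α → Bool := fun w => B.ruleIdx t < B.ruleIdx w with hp
  have htake : l.takeWhile p = l.filter p := takeWhile_eq_filter_of_pairwise <|
    (B.childrenByPriority_pairwise _).imp fun hvw hw =>
      decide_eq_true ((of_decide_eq_true hw).trans hvw)
  have hfind : (l.find? fun w => decide (B.ruleIdx w ≤ B.ruleIdx t)) = (l.dropWhile p).head? := by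
    rw [← List.find?_not_eq_head?_dropWhile]
    simp only [hp, ← decide_not, not_lt]
  have hflat : l.flatMap B.preorder =
      (l.filter p).flatMap B.preorder ++ (l.dropWhile p).flatMap B.preorder := by
    rw [← htake, ← List.flatMap_append, List.takeWhile_append_dropWhile]
  have hsplit : B.forestOrder order = P ++ (B.pre t :: (l.filter p).flatMap B.preorder) ++
      ((l.dropWhile p).flatMap B.preorder ++ S) := by
    rw [← hPS, B.preorder_eq (B.pre t), ← hl, hflat]
    simp only [List.append_assoc, List.cons_append]
  refine ⟨P, _, _, hsplit, hL, ?_, rfl⟩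
  rw [intervalR, ← hl, hfind]
  cases hdrop : l.dropWhile p with
  | nil =>
    rw [hdrop, List.flatMap_nil, List.append_nil] at hflat
    change B.intervalL order t + (B.preorder (B.pre t)).length = _
    rw [hL, B.preorder_eq (B.pre t), ← hl, hflat]
  | cons w l' =>
    rw [hdrop, List.flatMap_cons, B.preorder_eq w] at hsplit
    rw [← List.length_append]
    exact dfsIn_eq_length_of_forestOrder_eq hnodup hsplit

theorem SucEdge.inInterval_dfsIn_iff (hnodup : order.Nodup) (hall : ∀ c, c ∈ order)
    (h : B.SucEdge t v) :
    B.InInterval order t (B.dfsIn order k) ↔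
      k = B.pre t ∨ ∃ w, B.SucEdge w (B.pre t) ∧ B.Desc k w ∧ B.ruleIdx t < B.ruleIdx w := by
  obtain ⟨P, Q, S, hsplit, hL, hR, rfl⟩ := h.exists_segment hnodup hall
  rw [InInterval, hL, hR, dfsIn, hsplit,
    idxOf_mem_segment_iff (hsplit ▸ B.forestOrder_nodup hnodup), List.mem_cons, List.mem_flatMap]
  simp only [List.mem_filter, mem_childrenByPriority, mem_preorder, decide_eq_true_eq, and_assoc,
    and_comm (a := B.Desc _ _)]

theorem SucEdge.inInterval_dfsIn_lastToken_iff (hnodup : order.Nodup) (hall : ∀ c, c ∈ order)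
    (h : B.SucEdge t v) :
    B.InInterval order t (B.dfsIn order (B.lastToken s)) ↔ B.Desc (B.lastToken (s ++ v)) t := by
  rw [h.inInterval_dfsIn_iff hnodup hall, h.desc_lastToken_append_iff]

theorem SucEdge.not_inInterval_intervalL (hnodup : order.Nodup) (hall : ∀ c, c ∈ order)
    (hv : B.SucEdge v u) (hw : B.SucEdge w u) (hne : v ≠ w) :
    ¬ B.InInterval order v (B.intervalL order w) := by
  rw [intervalL, ← lastToken_of_mem_canon hw.pre_mem_canon,
    hv.inInterval_dfsIn_lastToken_iff hnodup hall, hw.pre_append, lastToken_of_mem_canon hw.1]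
  exact fun hdesc => hne (B.isForest_sucEdge.sibling_unique hv hw hdesc .refl)

theorem SucEdge.eq_of_intervalL_eq (hall : ∀ c, c ∈ order) (hv : B.SucEdge v u)
    (hw : B.SucEdge w u) (h : B.intervalL order v = B.intervalL order w) : v = w := by
  rw [← hv.pre_append, ← hw.pre_append, eq_of_dfsIn_eq hall hv.pre_mem_canon h]

end Intervals

section Components

variable {B : BPE α} {K S : Finset (List α)} {u v w : List α}

theorem mem_component :
    w ∈ B.component S v ↔ w ∈ S ∧ v ∈ S ∧ InducedReach B.SucEdge S v w := by
  classical exact Finset.mem_filter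

theorem component_subset (B : BPE α) (S : Finset (List α)) (v : List α) : B.component S v ⊆ S :=
  fun _ hw => (mem_component.1 hw).1

theorem component_eq_empty (hv : v ∉ S) : B.component S v = ∅ :=
  Finset.eq_empty_of_forall_notMem fun _ hw => hv (mem_component.1 hw).2.1

theorem inducedConnected_component (B : BPE α) (S : Finset (List α)) (v : List α) :
    InducedConnected B.SucEdge (B.component S v) := by
  have reach_of_mem {w : List α} (hw : w ∈ B.component S v) :
      InducedReach B.SucEdge (B.component S v) v w := by
    obtain ⟨-, hv, hvw⟩ := mem_component.1 hw
    clear hw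
    induction hvw with
    | refl => exact .refl
    | tail hva hab ih =>
      exact ih.tail ⟨mem_component.2 ⟨hab.1, hv, hva⟩,
        mem_component.2 ⟨hab.2.1, hv, hva.tail hab⟩, hab.2.2⟩
  exact fun a ha b hb => (reach_of_mem ha).symm.trans (reach_of_mem hb)

theorem exists_isCentroid (hK : InducedConnected B.SucEdge K) (hne : K.Nonempty) :
    ∃ u, B.IsCentroid K u := by
  obtain ⟨u, hu, hhalf⟩ := B.isForest_sucEdge.exists_centroid hK hne
  exact ⟨u, hu, fun v hv => hhalf v hv _ (B.component_subset _ v)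
    fun _ hk => (mem_component.1 hk).2.2⟩

theorem IsCentroid.two_mul_card_component_le (h : B.IsCentroid K u) (v : List α) :
    2 * (B.component (K.erase u) v).card ≤ K.card := by
  by_cases hv : v ∈ K.erase u
  · exact h.2 v hv
  · simp [component_eq_empty hv]

end Components

section CentroidSearchTrees

variable {B : BPE α} {K : Finset (List α)} {order τ u : List α} {T : CST α}

theorem mem_sufSucTree : u ∈ B.sufSucTree τ ↔ u ∈ B.canon ∧ u <:+ τ := Finset.mem_filter

theorem card_sufSucTree_le (B : BPE α) (τ : List α) : (B.sufSucTree τ).card ≤ τ.length := by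
  have hmaps : Set.MapsTo List.length (B.sufSucTree τ : Set (List α)) (Finset.Icc 1 τ.length) :=
    fun u hu => Finset.mem_coe.2 <| Finset.mem_Icc.2
      ⟨List.length_pos_iff.2 (ne_nil_of_mem_canon (mem_sufSucTree.1 hu).1),
        (mem_sufSucTree.1 hu).2.length_le⟩
  have hinj : Set.InjOn List.length (B.sufSucTree τ : Set (List α)) := fun u hu v hv huv =>
    (List.suffix_of_suffix_length_le (mem_sufSucTree.1 hu).2 (mem_sufSucTree.1 hv).2
      huv.le).eq_of_length huv
  simpa using Finset.card_le_card_of_injOn _ hmaps hinj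

theorem inducedConnected_sufSucTree (B : BPE α) (τ : List α) :
    InducedConnected B.SucEdge (B.sufSucTree τ) := by
  have reach_of_desc {u v : List α} (hu : u ∈ B.sufSucTree τ) (huv : B.Desc u v) :
      v ∈ B.sufSucTree τ ∧ InducedReach B.SucEdge (B.sufSucTree τ) u v := by
    induction huv with
    | refl => exact ⟨hu, .refl⟩
    | tail _ hvw ih =>
      have hw := mem_sufSucTree.2
        ⟨hvw.right_mem_canon, hvw.suffix.trans (mem_sufSucTree.1 ih.1).2⟩
      exact ⟨hw, ih.2.tail ⟨ih.1, hw, .inl hvw⟩⟩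
  intro u hu v hv
  obtain ⟨c, hc⟩ := exists_desc_singleton (mem_sufSucTree.1 hu).1
  obtain ⟨d, hd⟩ := exists_desc_singleton (mem_sufSucTree.1 hv).1
  obtain ⟨hcτ, huc⟩ := reach_of_desc hu hc
  obtain ⟨hdτ, hvd⟩ := reach_of_desc hv hd
  have hcd : [c] = [d] := (List.suffix_of_suffix_length_le (mem_sufSucTree.1 hcτ).2
    (mem_sufSucTree.1 hdτ).2 le_rfl).eq_of_length rfl
  exact huc.trans (hcd ▸ hvd.symm)

theorem exists_sorted_children (B : BPE α) (hall : ∀ c, c ∈ order) (τ u : List α) :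
    ∃ (n : ℕ) (child : Fin n → List α),
      (∀ v, v ∈ Set.range child ↔ v ∈ B.sufSucTree τ ∧ B.SucEdge v u) ∧
      StrictMono fun i => B.intervalL order (child i) := by
  let C := (B.sufSucTree τ).filter fun v => B.SucEdge v u
  let L := C.image (B.intervalL order)
  have hmem (i : Fin L.card) : ∃ v ∈ C, B.intervalL order v = L.orderEmbOfFin rfl i :=
    Finset.mem_image.1 (L.orderEmbOfFin_mem rfl i)
  choose child hchild hL using hmem
  refine ⟨L.card, child, fun v => ⟨?_, fun hv => ?_⟩, fun i j hij => ?_⟩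
  · rintro ⟨i, rfl⟩
    exact Finset.mem_filter.1 (hchild i)
  · have hLv : B.intervalL order v ∈ (L : Set ℕ) :=
      Finset.mem_coe.2 (Finset.mem_image_of_mem _ (Finset.mem_filter.2 hv))
    rw [← L.range_orderEmbOfFin rfl] at hLv
    obtain ⟨i, hi⟩ := hLv
    exact ⟨i, SucEdge.eq_of_intervalL_eq hall (Finset.mem_filter.1 (hchild i)).2 hv.2
      ((hL i).trans hi)⟩
  · simpa only [hL] using (L.orderEmbOfFin rfl).strictMono hij

theorem exists_isCST (hall : ∀ c, c ∈ order) (τ : List α)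
    (hK : InducedConnected B.SucEdge K) : ∃ T, B.IsCST order τ T K := by
  induction hn : K.card using Nat.strong_induction_on generalizing K with
  | _ n ih =>
    rcases K.eq_empty_or_nonempty with rfl | hne
    · exact ⟨.nil, rfl⟩
    obtain ⟨u, hu⟩ := exists_isCentroid hK hne
    have hsub (v : List α) : ∃ T, B.IsCST order τ T (B.component (K.erase u) v) :=
      ih _ (hn ▸ (Finset.card_le_card (B.component_subset _ v)).trans_lt
        (Finset.card_erase_lt_of_mem hu.1)) (B.inducedConnected_component _ v) rfl
    choose T hT using hsub
    obtain ⟨deg, child, hrange, hmono⟩ := B.exists_sorted_children hall τ u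
    exact ⟨.node u (T (B.suc u)) deg child fun i => T (child i), hu, hT _, hrange, hmono,
      fun i => hT _⟩

theorem exists_isCSTTable (B : BPE α) (hall : ∀ c, c ∈ order) :
    ∃ cst, B.IsCSTTable order cst := by
  choose T hT using fun τ => exists_isCST hall τ (B.inducedConnected_sufSucTree τ)
  exact ⟨T, fun τ _ => hT τ⟩

theorem IsCST.height_le {n : ℕ} (h : B.IsCST order τ T K) (hn : K.card < 2 ^ n) :
    T.height ≤ n := by
  induction T generalizing K n with
  | nil => exact Nat.zero_le n
  | node u up deg child down ihup ihdown =>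
    obtain ⟨hu, hup, -, -, hdown⟩ := h
    cases n with
    | zero =>
      have := Finset.card_pos.2 ⟨u, hu.1⟩
      omega
    | succ n =>
      have hhalf (v : List α) : (B.component (K.erase u) v).card < 2 ^ n := by
        have := hu.two_mul_card_component_le v
        rw [pow_succ] at hn
        omega
      exact Nat.succ_le_succ (max_le (ihup hup (hhalf _))
        (Finset.sup_le fun i _ => ihdown i (hdown i) (hhalf _)))

theorem IsCST.height_le_log (h : B.IsCST order τ T (B.sufSucTree τ)) :
    T.height ≤ Nat.log 2 τ.length + 1 :=
  h.height_le ((B.card_sufSucTree_le τ).trans_lt (Nat.lt_pow_succ_log_self Nat.one_lt_two _))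

end CentroidSearchTrees

section Automaton

variable {B : BPE α} {s t u v : List α} {c : α}

theorem IsState.of_prefix (h : B.IsState v) (huv : u <+: v) : B.IsState u :=
  h.imp fun _ ht => ⟨ht.1, huv.trans ht.2⟩

theorem isState_of_mem_canon (h : u ∈ B.canon) : B.IsState u := ⟨u, h, List.prefix_rfl⟩

theorem isLongestSuffix_link (hu : u ≠ []) : IsLongestSuffix B.IsState u.tail (B.link u) := by
  cases u with
  | nil => exact absurd rfl hu
  | cons a u => exact isLongestSuffix_find? B.IsState u

theorem isLongestSuffix_delta (B : BPE α) (u : List α) (c : α) :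
    IsLongestSuffix B.IsState (u ++ [c]) (B.delta u c) := by
  induction hn : u.length using Nat.strong_induction_on generalizing u with
  | _ n ih =>
    rw [delta]
    split_ifs with hstate hu
    · exact .self hstate
    · subst hu
      exact .of_tail hstate (.nil _)
    · refine .of_tail hstate ?_
      rw [List.tail_append_of_ne_nil hu]
      exact (isLongestSuffix_link hu).concat (fun _ ht => ht.of_prefix (List.prefix_append ..))
        (ih _ (hn ▸ B.length_link_lt hu) _ rfl)

theorem isLongestSuffix_annot (B : BPE α) (u : List α) :
    IsLongestSuffix (· ∈ B.canon) u (B.annot u) := by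
  induction hn : u.length using Nat.strong_induction_on generalizing u with
  | _ n ih =>
    rw [annot]
    split_ifs with hcanon hu
    · exact .self hcanon
    · subst hu
      exact .nil _
    · exact .of_tail hcanon ((isLongestSuffix_link hu).trans (fun _ => isState_of_mem_canon)
        (ih _ (hn ▸ B.length_link_lt hu) _ rfl))

theorem acState_concat (B : BPE α) (s : List α) (c : α) :
    B.acState (s ++ [c]) = B.delta (B.acState s) c :=
  List.foldl_append ..

theorem isLongestSuffix_acState (B : BPE α) (s : List α) :
    IsLongestSuffix B.IsState s (B.acState s) := by
  induction s using List.reverseRecOn with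
  | nil => exact .nil _
  | append_singleton s c ih =>
    rw [acState_concat]
    exact ih.concat (fun _ ht => ht.of_prefix (List.prefix_append ..)) (B.isLongestSuffix_delta _ c)

theorem isLongestSuffix_longestSuffixToken (B : BPE α) (s : List α) :
    IsLongestSuffix (· ∈ B.canon) s (B.longestSuffixToken s) :=
  isLongestSuffix_find? (· ∈ B.canon) s

theorem annot_acState (B : BPE α) (s : List α) :
    B.annot (B.acState s) = B.longestSuffixToken s :=
  ((B.isLongestSuffix_acState s).trans (fun _ => isState_of_mem_canon)
    (B.isLongestSuffix_annot _)).unique (B.isLongestSuffix_longestSuffixToken s)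

theorem longestSuffixToken_suffix (B : BPE α) (s : List α) : B.longestSuffixToken s <:+ s :=
  (B.isLongestSuffix_longestSuffixToken s).1

theorem lastToken_suffix_longestSuffixToken (hs : s ≠ []) :
    B.lastToken s <:+ B.longestSuffixToken s :=
  (B.isLongestSuffix_longestSuffixToken s).2.2 _ (B.lastToken_suffix s) (B.lastToken_mem_canon hs)

theorem longestSuffixToken_mem_canon (B : BPE α) (hs : s ≠ []) :
    B.longestSuffixToken s ∈ B.canon := by
  refine (B.isLongestSuffix_longestSuffixToken s).2.1.resolve_right fun hnil => ?_
  have hsuffix := lastToken_suffix_longestSuffixToken (B := B) hs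
  rw [hnil, List.suffix_nil] at hsuffix
  exact ne_nil_of_mem_canon (B.lastToken_mem_canon hs) hsuffix

end Automaton

section BinarySearch

variable {n : ℕ} {key : Fin n → ℕ} {x lo hi : ℕ}

theorem bsearch_spec (hkey : Monotone key) (hn : hi ≤ n) (hle : lo ≤ hi)
    (hlo : ∀ i : Fin n, i < lo → key i ≤ x) (hhi : ∀ i : Fin n, hi ≤ i → x < key i) :
    (bsearch key x lo hi hn).val ≤ n ∧
      (∀ i : Fin n, i < (bsearch key x lo hi hn).val → key i ≤ x) ∧
      ∀ i : Fin n, (bsearch key x lo hi hn).val ≤ i → x < key i := by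
  induction hd : hi - lo using Nat.strong_induction_on generalizing lo hi with
  | _ d ih =>
    rw [bsearch]
    by_cases hlt : lo < hi
    · simp only [Cost.op_bind, hlt, dite_true, decide_eq_true_eq]
      split_ifs with hmid
      · refine ih _ ?_ hn (by omega) (fun i hi => ?_) hhi rfl
        · omega
        · exact (hkey (Fin.le_def.2 (Nat.le_of_lt_succ hi))).trans hmid
      · refine ih _ ?_ _ (by omega) hlo (fun i hi => ?_) rfl
        · omega
        · exact (not_le.1 hmid).trans_le (hkey (Fin.le_def.2 hi))
    · obtain rfl : lo = hi := by omega
      simp only [Cost.op_bind, Cost.val_ret, hlt, dite_false]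
      exact ⟨hn, hlo, hhi⟩

theorem bsearch_val_eq_succ (hkey : Monotone key) {i : Fin n} (hi : key i ≤ x)
    (hlast : ∀ j, i < j → x < key j) : (bsearch key x 0 n le_rfl).val = i + 1 := by
  obtain ⟨hle, hbelow, habove⟩ := bsearch_spec (x := x) hkey le_rfl (Nat.zero_le n)
    (fun i hi => absurd hi (Nat.not_lt_zero _)) (fun i hi => absurd i.2 hi.not_gt)
  refine le_antisymm (not_lt.1 fun hlt => ?_) (Nat.succ_le_of_lt (not_le.1 fun hge => ?_))
  · exact (hbelow ⟨i + 1, by omega⟩ hlt).not_gt (hlast _ (Fin.lt_def.2 (Nat.lt_succ_self _)))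
  · exact (habove i hge).not_ge hi

theorem bsearch_time_le (key : Fin n → ℕ) (x : ℕ) (hn : hi ≤ n) {m : ℕ} (hm : hi - lo < 2 ^ m) :
    (bsearch key x lo hi hn).time ≤ 4 * m + 1 := by
  induction m generalizing lo hi with
  | zero =>
    rw [bsearch]
    have hge : ¬ lo < hi := by omega
    simp [hge]
  | succ m ih =>
    rw [bsearch]
    rw [pow_succ] at hm
    by_cases hlt : lo < hi
    · simp only [Cost.op_bind, hlt, dite_true, decide_eq_true_eq]
      split_ifs
      · have := ih hn (lo := (lo + hi) / 2 + 1) (by omega)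
        omega
      · have := ih (lo := lo) (hi := (lo + hi) / 2) (by omega) (by omega)
        omega
    · simp [hlt]

end BinarySearch

section Search

variable {B : BPE α} {order s u v w τ : List α} {H : ℕ → List α} {x m deg : ℕ}
  {child : Fin deg → List α} {T : CST α} {K : Finset (List α)}

theorem inInterval_val : (B.inInterval order v x).val = true ↔ B.InInterval order v x := by
  simp [inInterval, InInterval]

theorem inInterval_time (B : BPE α) (order v : List α) (x : ℕ) :
    (B.inInterval order v x).time = 5 := rfl

theorem checkNode_val :
    (B.checkNode order H u).val = true ↔
      u.length ≤ 1 ∨ B.InInterval order u (B.dfsIn order (H (B.suc u).length)) := by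
  by_cases h : u.length ≤ 1 <;> simp [checkNode, h, inInterval_val]

theorem checkNode_time_le (B : BPE α) (order : List α) (H : ℕ → List α) (u : List α) :
    (B.checkNode order H u).time ≤ 10 := by
  by_cases h : u.length ≤ 1 <;> simp [checkNode, h, inInterval_time]

theorem findChild_time_le (B : BPE α) (order : List α) (H : ℕ → List α) (u : List α)
    (child : Fin deg → List α) (hm : deg < 2 ^ m) :
    (B.findChild order H u child).time ≤ 4 * m + 11 := by
  have hbsearch := bsearch_time_le (fun i => B.intervalL order (child i))
    (B.dfsIn order (H u.length)) (lo := 0) le_rfl hm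
  simp only [findChild, Cost.op_bind, Cost.time_bind]
  split_ifs <;> simp only [Cost.time_ret, inInterval_time] <;> omega

theorem inInterval_of_findChild_eq_some {i : Fin deg}
    (h : (B.findChild order H u child).val = some i) :
    B.InInterval order (child i) (B.dfsIn order (H u.length)) := by
  simp only [findChild, Cost.op_bind, Cost.val_bind] at h
  split_ifs at h with _ hin <;> simp only [Cost.val_ret, reduceCtorEq] at h
  obtain rfl := Option.some.inj h
  exact inInterval_val.1 hin

theorem findChild_eq_some (hmono : Monotone fun i => B.intervalL order (child i)) {i : Fin deg}
    (hi : B.InInterval order (child i) (B.dfsIn order (H u.length)))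
    (hlast : ∀ j, i < j → B.dfsIn order (H u.length) < B.intervalL order (child j)) :
    (B.findChild order H u child).val = some i := by
  have hfound := bsearch_val_eq_succ hmono hi.1 hlast
  simp only [findChild, Cost.op_bind, Cost.val_bind, hfound]
  rw [dif_pos ⟨Nat.succ_pos _, i.2⟩]
  simp [inInterval_val.2 hi]

theorem SucEdge.inInterval_history_iff (hnodup : order.Nodup) (hall : ∀ c, c ∈ order)
    (hH : B.IsHistory w H) (h : B.SucEdge v u) (hvw : v <:+ w) :
    B.InInterval order v (B.dfsIn order (H u.length)) ↔ B.Desc (B.lastToken w) v := by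
  have hpos := List.length_pos_iff.2 (ne_nil_of_mem_canon h.right_mem_canon)
  have hlt := h.length_lt.trans_le hvw.length_le
  obtain ⟨s, rfl⟩ := hvw
  obtain ⟨y, rfl⟩ := h.suffix
  have htake : (s ++ (y ++ u)).take ((s ++ (y ++ u)).length - u.length) = s ++ y := by
    rw [← List.append_assoc, List.length_append, Nat.add_sub_cancel, List.take_left]
  rw [hH u.length hpos hlt, htake, h.inInterval_dfsIn_lastToken_iff hnodup hall,
    List.append_assoc]

theorem checkNode_val_iff_desc (hnodup : order.Nodup) (hall : ∀ c, c ∈ order)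
    (hH : B.IsHistory w H) (hu : u ∈ B.canon) (huw : u <:+ w) :
    (B.checkNode order H u).val = true ↔ B.Desc (B.lastToken w) u := by
  rw [checkNode_val]
  by_cases hlen : 1 < u.length
  · rw [SucEdge.inInterval_history_iff hnodup hall hH ⟨hu, hlen, rfl⟩ huw, or_iff_right hlen.not_ge]
  · refine iff_of_true (.inl (not_lt.1 hlen)) ?_
    have hw : w ≠ [] := fun hw => ne_nil_of_mem_canon hu (List.suffix_nil.1 (hw ▸ huw))
    obtain ⟨c, hc⟩ := exists_desc_singleton (B.lastToken_mem_canon hw)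
    have huc : u <:+ [c] := List.suffix_of_suffix_length_le huw
      (hc.suffix.trans (B.lastToken_suffix w)) (not_lt.1 hlen)
    rwa [huc.eq_of_length_le (List.length_pos_iff.2 (ne_nil_of_mem_canon hu))]

theorem findChild_eq_none_of_lastToken_eq (hnodup : order.Nodup) (hall : ∀ c, c ∈ order)
    (hH : B.IsHistory w H) (hu : B.lastToken w = u)
    (hchild : ∀ i, B.SucEdge (child i) u ∧ child i <:+ w) :
    (B.findChild order H u child).val = none := by
  refine Option.eq_none_iff_forall_ne_some.2 fun i hi => ?_
  obtain ⟨hedge, hsuffix⟩ := hchild i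
  have hdesc := (hedge.inInterval_history_iff hnodup hall hH hsuffix).1
    (inInterval_of_findChild_eq_some hi)
  exact B.isForest_sucEdge.not_reflTransGen_of_rel hedge (hu ▸ hdesc)

theorem findChild_eq_some_of_desc (hnodup : order.Nodup) (hall : ∀ c, c ∈ order)
    (hH : B.IsHistory w H) (hchild : ∀ i, B.SucEdge (child i) u ∧ child i <:+ w)
    (hmono : StrictMono fun i => B.intervalL order (child i)) {i : Fin deg}
    (hdesc : B.Desc (B.lastToken w) (child i)) :
    (B.findChild order H u child).val = some i := by
  obtain ⟨hedge, hsuffix⟩ := hchild i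
  have hi := (hedge.inInterval_history_iff hnodup hall hH hsuffix).2 hdesc
  refine findChild_eq_some hmono.monotone hi fun j hij => not_le.1 fun hle => ?_
  have hne : child i ≠ child j := fun heq =>
    (hmono hij).ne (congrArg (B.intervalL order) heq)
  exact hedge.not_inInterval_intervalL hnodup hall (hchild j).1 hne
    ⟨(hmono hij).le, hle.trans_lt hi.2⟩

theorem IsCST.search_val (hnodup : order.Nodup) (hall : ∀ c, c ∈ order) (hH : B.IsHistory w H)
    (hτ : τ <:+ w) (hT : B.IsCST order τ T K) (hK : InducedConnected B.SucEdge K)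
    (hKτ : K ⊆ B.sufSucTree τ) (hw : B.lastToken w ∈ K) :
    (B.search order H T).val = B.lastToken w := by
  induction T generalizing K with
  | nil =>
    obtain rfl : K = ∅ := hT
    exact absurd hw (Finset.notMem_empty _)
  | node u up deg child down ihup ihdown =>
    obtain ⟨hu, hup, hrange, hmono, hdown⟩ := hT
    have hchild (i : Fin deg) : B.SucEdge (child i) u ∧ child i <:+ w :=
      have hi := (hrange (child i)).1 ⟨i, rfl⟩
      ⟨hi.2, (mem_sufSucTree.1 hi.1).2.trans hτ⟩
    have hsub (v : List α) : B.component (K.erase u) v ⊆ B.sufSucTree τ :=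
      (B.component_subset _ v).trans ((Finset.erase_subset _ _).trans hKτ)
    have hcheck := checkNode_val_iff_desc hnodup hall hH (mem_sufSucTree.1 (hKτ hu.1)).1
      ((mem_sufSucTree.1 (hKτ hu.1)).2.trans hτ)
    rw [search]
    by_cases hdesc : B.Desc (B.lastToken w) u
    · by_cases heq : B.lastToken w = u
      · simp [hcheck.2 hdesc, findChild_eq_none_of_lastToken_eq hnodup hall hH heq hchild, heq]
      · obtain ⟨v, hv, hvu, hdesc', hreach⟩ :=
          B.isForest_sucEdge.exists_reach_child hK hu.1 hw heq hdesc
        obtain ⟨i, rfl⟩ := (hrange v).2 ⟨hKτ (Finset.mem_of_mem_erase hv), hvu⟩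
        have hsome := findChild_eq_some_of_desc hnodup hall hH hchild hmono hdesc'
        have hmem := mem_component.2 ⟨Finset.mem_erase.2 ⟨heq, hw⟩, hv, hreach⟩
        simp [hcheck.2 hdesc, hsome,
          ihdown i (hdown i) (B.inducedConnected_component _ _) (hsub _) hmem]
    · obtain ⟨v, hv, huv, hreach⟩ := B.isForest_sucEdge.exists_reach_parent hK hu.1 hw hdesc
      obtain rfl : B.suc u = v := huv.2.2
      have heq : B.lastToken w ≠ u := fun heq => hdesc (heq ▸ .refl)
      have hmem := mem_component.2 ⟨Finset.mem_erase.2 ⟨heq, hw⟩, hv, hreach⟩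
      simp [Bool.eq_false_iff.2 (mt hcheck.1 hdesc),
        ihup hup (B.inducedConnected_component _ _) (hsub _) hmem]

theorem deg_le_length (hrange : ∀ v ∈ Set.range child, v ∈ B.sufSucTree τ)
    (hmono : StrictMono fun i => B.intervalL order (child i)) : deg ≤ τ.length := by
  have hinj : Function.Injective child := fun i j hij =>
    hmono.injective (congrArg (B.intervalL order) hij)
  have hcard := Finset.card_le_card_of_injOn (s := Finset.univ) (t := B.sufSucTree τ) child
    (fun i _ => hrange _ ⟨i, rfl⟩) hinj.injOn
  rw [Finset.card_fin] at hcard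
  exact hcard.trans (B.card_sufSucTree_le τ)

theorem IsCST.search_time_le (hT : B.IsCST order τ T K) (H : ℕ → List α)
    (hm : τ.length < 2 ^ m) :
    (B.search order H T).time ≤ T.height * (4 * m + 22) := by
  induction T generalizing K with
  | nil => simp [search]
  | node u up deg child down ihup ihdown =>
    obtain ⟨-, hup, hrange, hmono, hdown⟩ := hT
    have hdeg : deg ≤ τ.length := deg_le_length (fun v hv => ((hrange v).1 hv).1) hmono
    have hcheck := B.checkNode_time_le order H u
    have hfind := B.findChild_time_le order H u child (hdeg.trans_lt hm)
    have subtree_time_le {T : CST α} (hT : (B.search order H T).time ≤ T.height * (4 * m + 22))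
        (hle : T.height ≤ max up.height (Finset.univ.sup fun i => (down i).height)) :=
      hT.trans (Nat.mul_le_mul_right _ hle)
    rw [search, CST.height, add_one_mul, Cost.time_bind]
    split_ifs
    · rw [Cost.time_bind]
      cases (B.findChild order H u child).val with
      | none =>
        rw [Cost.time_ret]
        omega
      | some i =>
        have := subtree_time_le (ihdown i (hdown i))
          (le_max_of_le_right (Finset.le_sup (f := fun i => (down i).height) (Finset.mem_univ i)))
        simp only [Cost.op_bind]
        omega
    · have := subtree_time_le (ihup hup) (le_max_left _ _)
      simp only [Cost.op_bind]
      omega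

end Search

section Update

variable {B : BPE α} {order s : List α} {cst : List α → CST α} {c : α}

theorem update_val (hnodup : order.Nodup) (hall : ∀ c, c ∈ order)
    (hcst : B.IsCSTTable order cst) {H : ℕ → List α} (hH : B.IsHistory (s ++ [c]) H) :
    (B.update order cst H (B.acState s) c).val =
      (B.acState (s ++ [c]), B.lastToken (s ++ [c])) := by
  have hs := List.concat_ne_nil c s
  have hroot : B.lastToken (s ++ [c]) ∈ B.sufSucTree (B.longestSuffixToken (s ++ [c])) :=
    mem_sufSucTree.2 ⟨B.lastToken_mem_canon hs, lastToken_suffix_longestSuffixToken hs⟩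
  have hsearch := (hcst _ (B.longestSuffixToken_mem_canon hs)).search_val hnodup hall hH
    (B.longestSuffixToken_suffix _) (B.inducedConnected_sufSucTree _) subset_rfl hroot
  simp only [update, Cost.op_bind, Cost.val_bind, Cost.val_ret, ← acState_concat, annot_acState,
    hsearch]

theorem update_time_le (hcst : B.IsCSTTable order cst) (s : List α) (c : α) (H : ℕ → List α) :
    (B.update order cst H (B.acState s) c).time ≤
      3 + (Nat.log 2 (B.longestSuffixToken (s ++ [c])).length + 1) *
        (4 * (Nat.log 2 (B.longestSuffixToken (s ++ [c])).length + 1) + 22) := by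
  have hT := hcst _ (B.longestSuffixToken_mem_canon (List.concat_ne_nil c s))
  have hsearch := (hT.search_time_le H (Nat.lt_pow_succ_log_self one_lt_two _)).trans
    (Nat.mul_le_mul_right _ hT.height_le_log)
  rw [Nat.succ_eq_add_one] at hsearch
  simp only [update, Cost.op_bind, Cost.time_bind, Cost.time_ret, ← acState_concat, annot_acState]
  omega

theorem natLog_two_le_two_mul_log {n : ℕ} (hn : n ≠ 0) :
    (Nat.log 2 n : ℝ) ≤ 2 * Real.log n := by
  have hpow : ((2 : ℝ) ^ Nat.log 2 n) ≤ n := by exact_mod_cast Nat.pow_log_le_self 2 hn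
  have hlog := Real.log_le_log (by positivity) hpow
  rw [Real.log_pow] at hlog
  have := Real.log_two_gt_d9
  have : (0 : ℝ) ≤ Nat.log 2 n := Nat.cast_nonneg _
  nlinarith

theorem update_time_le_log_sq (hcst : B.IsCSTTable order cst) (s : List α) (c : α)
    (H : ℕ → List α) :
    ((B.update order cst H (B.acState s) c).time : ℝ) ≤
      59 * (1 + Real.log (B.longestSuffixToken (s ++ [c])).length ^ 2) := by
  have htime : ((B.update order cst H (B.acState s) c).time : ℝ) ≤ _ :=
    Nat.cast_le.2 (update_time_le hcst s c H)
  have hlog := natLog_two_le_two_mul_log (List.length_pos_iff.2 <| ne_nil_of_mem_canon <|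
    B.longestSuffixToken_mem_canon <| List.concat_ne_nil c s).ne'
  refine htime.trans ?_
  push_cast
  have hsq := pow_le_pow_left₀ (Nat.cast_nonneg _) hlog 2
  nlinarith [sq_nonneg (Real.log (B.longestSuffixToken (s ++ [c])).length - 1)]

end Update

section Run

variable {B : BPE α} {order s : List α} {cst : List α → CST α}

/-- The data held by the algorithm after reading `s`: the automaton state and the array of the
last tokens of all prefixes of `s`. -/
def memoryAfter (B : BPE α) (s : List α) : Memory α :=
  ⟨B.acState s, (s.inits.map B.lastToken).toArray⟩

theorem isHistory_memoryAfter (B : BPE α) (s : List α) (c : α) :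
    B.IsHistory (s ++ [c]) fun ℓ =>
      (B.memoryAfter s).hist.getD ((B.memoryAfter s).hist.size - ℓ) [] := by
  intro ℓ hpos hlt
  have hlen : (s ++ [c]).length = s.length + 1 := List.length_append ..
  have hle : s.length + 1 - ℓ ≤ s.length := by omega
  rw [hlen, List.take_append_of_le_length hle]
  simp [memoryAfter, Nat.lt_succ_of_le hle]

theorem step_val (hnodup : order.Nodup) (hall : ∀ c, c ∈ order) (hcst : B.IsCSTTable order cst)
    (s : List α) (c : α) :
    (B.step order cst (B.memoryAfter s) c).val = B.memoryAfter (s ++ [c]) := by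
  have hupdate := update_val hnodup hall hcst (B.isHistory_memoryAfter s c)
  change Memory.mk (Cost.val (B.update order cst _ (B.acState s) c)).1
    ((B.memoryAfter s).hist.push (Cost.val (B.update order cst _ (B.acState s) c)).2) = _
  rw [hupdate]
  simp [memoryAfter]

theorem step_time_le (hcst : B.IsCSTTable order cst) (s : List α) (c : α) :
    ((B.step order cst (B.memoryAfter s) c).time : ℝ) ≤ 60 * (1 + Real.log B.maxLen ^ 2) := by
  have hupdate := update_time_le_log_sq hcst s c fun ℓ =>
    (B.memoryAfter s).hist.getD ((B.memoryAfter s).hist.size - ℓ) []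
  have hτ := B.longestSuffixToken_mem_canon (List.concat_ne_nil c s)
  have hpos : (1 : ℝ) ≤ (B.longestSuffixToken (s ++ [c])).length :=
    Nat.one_le_cast.2 (List.length_pos_iff.2 (ne_nil_of_mem_canon hτ))
  have hlog : Real.log (B.longestSuffixToken (s ++ [c])).length ≤ Real.log B.maxLen :=
    Real.log_le_log (by linarith) (Nat.cast_le.2 (length_le_maxLen hτ))
  have hsq := pow_le_pow_left₀ (Real.log_nonneg hpos) hlog 2
  change ((Cost.time (B.update order cst _ (B.acState s) c) + 1 : ℕ) : ℝ) ≤ _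
  rw [Nat.cast_succ]
  nlinarith [sq_nonneg (Real.log B.maxLen)]

theorem runFrom_val (hnodup : order.Nodup) (hall : ∀ c, c ∈ order)
    (hcst : B.IsCSTTable order cst) (s t : List α) :
    (B.runFrom order cst (B.memoryAfter s) t).val = B.memoryAfter (s ++ t) := by
  induction t generalizing s with
  | nil => rw [runFrom, Cost.val_ret, List.append_nil]
  | cons c t ih =>
    rw [runFrom, Cost.val_bind, step_val hnodup hall hcst, ih, List.append_assoc,
      List.singleton_append]

theorem runFrom_time_le (hnodup : order.Nodup) (hall : ∀ c, c ∈ order)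
    (hcst : B.IsCSTTable order cst) (s t : List α) :
    ((B.runFrom order cst (B.memoryAfter s) t).time : ℝ) ≤
      60 * (t.length * (1 + Real.log B.maxLen ^ 2)) := by
  induction t generalizing s with
  | nil => simp [runFrom]
  | cons c t ih =>
    have hstep := step_time_le hcst s c
    have hrest := ih (s ++ [c])
    rw [runFrom, Cost.time_bind, step_val hnodup hall hcst]
    push_cast [List.length_cons]
    linarith

theorem run_eq_runFrom_memoryAfter_nil (B : BPE α) (order : List α) (cst : List α → CST α)
    (s : List α) : B.run order cst s = B.runFrom order cst (B.memoryAfter []) s := by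
  have hinit : B.memoryAfter [] = ⟨[], #[[]]⟩ := by
    simp [memoryAfter, acState, ← lastTokenAfter_rules, lastTokenAfter_nil]
  rw [run, hinit]

end Run

end BPE

theorem mainTheorem3 :
    ∃ C : ℝ, ∀ (α : Type*) [Fintype α] [DecidableEq α] (B : BPE α)
      (order : List α), order.Nodup → (∀ c, c ∈ order) →
      (∃ cst, B.IsCSTTable order cst) ∧
      ∀ cst, B.IsCSTTable order cst →
        -- the height of the centroid search trees
        (∀ τ ∈ B.canon, (cst τ).height ≤ Nat.log 2 τ.length + 1) ∧
        -- appending one character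
        (∀ (s : List α) (c : α) (H : ℕ → List α), B.IsHistory (s ++ [c]) H →
          B.annot (B.acState (s ++ [c])) = B.longestSuffixToken (s ++ [c]) ∧
          (B.update order cst H (B.acState s) c).val =
            (B.acState (s ++ [c]), B.lastToken (s ++ [c])) ∧
          ((B.update order cst H (B.acState s) c).time : ℝ) ≤
            C * (1 + Real.log (B.longestSuffixToken (s ++ [c])).length ^ 2)) ∧
        -- processing the whole input
        (∀ s : List α,
          (B.run order cst s).val.hist.toList = s.inits.map B.lastToken ∧
          (∀ c, ((B.step order cst (B.run order cst s).val c).time : ℝ) ≤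
            C * (1 + Real.log B.maxLen ^ 2)) ∧
          ((B.run order cst s).time : ℝ) ≤
            C * (s.length * (1 + Real.log B.maxLen ^ 2))) := by
  refine ⟨60, fun α _ _ B order hnodup hall => ⟨B.exists_isCSTTable hall, fun cst hcst =>
    ⟨fun τ hτ => (hcst τ hτ).height_le_log, fun s c H hH => ⟨B.annot_acState _,
      BPE.update_val hnodup hall hcst hH, ?_⟩, fun s => ?_⟩⟩⟩
  · have := BPE.update_time_le_log_sq hcst s c H
    nlinarith [sq_nonneg (Real.log (B.longestSuffixToken (s ++ [c])).length)]
  · rw [BPE.run_eq_runFrom_memoryAfter_nil, BPE.runFrom_val hnodup hall hcst, List.nil_append]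
    exact ⟨rfl, BPE.step_time_le hcst s, BPE.runFrom_time_le hnodup hall hcst [] s⟩
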